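/- Let $N\ge 1$, let $f(z)=\sum_{l\ge1}a(l)e^{2\pi i l z}$ be a cusp form of weight $2$ for $\Gamma_0(N)$, and let $\chi$ be a primitive Dirichlet character modulo $N$ with $\chi(-1)=1$; put $\chi(\gamma)=\chi(d)$ for $\gamma=\left(\begin{smallmatrix}a&b\\c&d\end{smallmatrix}\right)\in\Gamma_0(N)$. Let $\Gamma_\infty$ be the stabilizer of $\infty$ in $\Gamma_0(N)$, consisting of the matrices $\left(\begin{smallmatrix}\pm1&*\\0&\pm1\end{smallmatrix}\right)$, let $\langle f,\gamma\rangle=\int_{i\infty}^{\gamma i\infty}f(w)\,dw$ be the modular symbol, and for $z=x+iy$ in the upper half-plane let $$E^*(z,s;\chi)=\sum_{\gamma\in\Gamma_\infty\backslash\Gamma_0(N)}\overline{\chi(\gamma)}\,\langle f,\gamma\rangle\,\mathrm{Im}(\gamma z)^s .$$ Put $W(\bar\chi)=\sum_{a \bmod N}\bar\chi(a)e^{2\pi i a/N}$, $L(\chi,s)=\sum_{n\ge1}\chi(n)n^{-s}$, $\sigma^\chi_t(m)=\sum_{d\mid m}\chi(d)d^t$ and $W_s(nz)=2\sqrt{|n|y}\,K_{s-1/2}(2\pi|n|y)\,e^{2\pi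 i n x}$ for $n\neq 0$, where $K$ is the modified Bessel function. Let $L(f,s)=\sum_{l\ge1} a(l)l^{-s}$, and let $L(f\otimes\chi,s)$ be the analytic continuation of $\sum_{l\ge1} a(l)\chi(l)l^{-s}$. For $n\ne0$ and $\mathrm{Re}(s)>2$ let $L(n,\chi;s)$ be the value at $t=1$ of the analytic continuation (to a half-plane containing $t=1$) of the series $$\sum_{l\ge1,\;m=l-n\ne0}\frac{a(l)\,\sigma^\chi_{2s-1}(|m|)}{l^t\,|m|^{2s-1}},$$ which converges absolutely for $\mathrm{Re}(t)>3/2$. Theorem. Let $\mathrm{Re}(s)>2$. The series $E^*(z,s;\chi)$ converges absolutely and has a unique Fourier expansion $$E^*(z,s;\chi)=\phi^*(s,\chi)\,y^{1-s}+\sum_{n\ne0}\phi^*(n,s,\chi)\,W_s(nz).$$ For every $n\neq0$ the continuation defining $L(n,\chi;s)$ exists, and $$L(n,\chi;s)=\frac{2\,\Gamma(s)\,N^{2s}\,L(\bar\chi,2s)}{i\,W(\bar\chi)\,(\pi|n|)^{s-1}}\;\phi^*(n,s,\chi).$$ If moreover $f$ is a Hecke eigenform (for all $T_p$ with $p$ prime,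 $p\nmid N$) normalized by $a(1)=1$, then $L(f\otimes\chi,1)$ is defined, by analytic continuation from $\mathrm{Re}(t)>3/2$ to a half-plane containing $t=1$, and $$\phi^*(s,\chi)=\frac{i\,W(\bar\chi)\,\Gamma(s-\frac12)}{2\,\pi^{1/2}\,N^{2s}\,\Gamma(s)}\;\frac{L(f\otimes\chi,1)\,L(f,2s)}{L(\bar\chi,2s)\,L(\chi,2s)} .$$ -/

import Mathlib

open UpperHalfPlane hiding I
open Complex
open scoped MatrixGroups CongruenceSubgroup ComplexConjugate

/-! ### Cusp forms of weight two and their Dirichlet series -/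

/-- Cusp forms of weight `2` for `Γ₀(N)`. -/
abbrev CuspForm2 (N : ℕ) : Type :=
  CuspForm ((CongruenceSubgroup.Gamma0 N).map (Matrix.SpecialLinearGroup.mapGL ℝ)) 2

/-- The Fourier coefficients `a(n)` in `f(z) = ∑ a(n) e^{2πinz}`. -/
noncomputable def cuspCoeff {N : ℕ} (f : CuspForm2 N) (n : ℕ) : ℂ :=
  (qExpansion 1 f).coeff n

/-- The Hecke operator `T_p` in weight `2`, for a prime `p` not dividing the level:
`(T_p f)(z) = p f(pz) + p⁻¹ ∑_{b mod p} f((z + b) / p)`. -/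
noncomputable def heckeT (p : ℕ) (f : ℍ → ℂ) (z : ℍ) : ℂ :=
  p * f (ofComplex (p * z)) + (p : ℂ)⁻¹ * ∑ b ∈ Finset.range p, f (ofComplex (((z : ℂ) + b) / p))

/-- `f` is a Hecke eigenform (for all `T_p` with `p ∤ N`), normalized by `a(1) = 1`. -/
def IsNormalizedEigenform {N : ℕ} (f : CuspForm2 N) : Prop :=
  cuspCoeff f 1 = 1 ∧
    ∀ p : ℕ, p.Prime → ¬ p ∣ N → ∃ c : ℂ, ∀ z : ℍ, heckeT p f z = c * f z

/-- The Dirichlet series `∑_{l ≥ 1} b(l) l^{-t}` converges absolutely for `Re t > σ₀`, it has an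
analytic continuation to a half-plane containing `t₀`, and the value of the continuation at `t₀`
is `v`. -/
def HasContinuedValue (b : ℕ → ℂ) (σ₀ : ℝ) (t₀ v : ℂ) : Prop :=
  ∃ σ₁ : ℝ, σ₁ < t₀.re ∧ ∃ G : ℂ → ℂ, DifferentiableOn ℂ G {t : ℂ | σ₁ < t.re} ∧
    (∀ t : ℂ, σ₀ < t.re → LSeriesHasSum b t (G t)) ∧ G t₀ = v

/-- The value of the continuation is unique. -/
theorem HasContinuedValue.unique {b : ℕ → ℂ} {σ₀ : ℝ} {t₀ v w : ℂ}
    (hv : HasContinuedValue b σ₀ t₀ v) (hw : HasContinuedValue b σ₀ t₀ w) : v = w := by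
  obtain ⟨σ₁, h₁, G, hG, hGs, rfl⟩ := hv
  obtain ⟨σ₂, h₂, H, hH, hHs, rfl⟩ := hw
  have hopen (σ : ℝ) : IsOpen {t : ℂ | σ < t.re} := isOpen_lt continuous_const continuous_re
  have hU := hopen (max σ₁ σ₂)
  have hGa : AnalyticOnNhd ℂ G {t : ℂ | max σ₁ σ₂ < t.re} :=
    (hG.mono fun t ht => lt_of_le_of_lt (le_max_left σ₁ σ₂) ht).analyticOnNhd hU
  have hHa : AnalyticOnNhd ℂ H {t : ℂ | max σ₁ σ₂ < t.re} :=
    (hH.mono fun t ht => lt_of_le_of_lt (le_max_right σ₁ σ₂) ht).analyticOnNhd hU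
  have hconv : Convex ℝ {t : ℂ | max σ₁ σ₂ < t.re} := convex_halfSpace_re_gt _
  let z : ℂ := ((max (max σ₁ σ₂) σ₀ + 1 : ℝ) : ℂ)
  have hz : z.re = max (max σ₁ σ₂) σ₀ + 1 := ofReal_re _
  have hz1 : max σ₁ σ₂ < z.re := by
    rw [hz]; exact lt_of_le_of_lt (le_max_left _ _) (lt_add_one _)
  have hz2 : σ₀ < z.re := by
    rw [hz]; exact lt_of_le_of_lt (le_max_right _ _) (lt_add_one _)
  refine hGa.eqOn_of_preconnected_of_eventuallyEq hHa hconv.isPreconnected hz1 ?_ (max_lt h₁ h₂)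
  filter_upwards [(hopen σ₀).mem_nhds hz2] with t ht
  exact (hGs t ht).unique (hHs t ht)

open Classical in
/-- The value at `t₀` of the analytic continuation of `∑_{l ≥ 1} b(l) l^{-t}`, `Re t > σ₀`
(and `0` if there is no continuation). -/
noncomputable def continuedValue (b : ℕ → ℂ) (σ₀ : ℝ) (t₀ : ℂ) : ℂ :=
  if h : ∃ v, HasContinuedValue b σ₀ t₀ v then h.choose else 0

theorem HasContinuedValue.continuedValue_eq {b : ℕ → ℂ} {σ₀ : ℝ} {t₀ v : ℂ}
    (hv : HasContinuedValue b σ₀ t₀ v) : continuedValue b σ₀ t₀ = v := by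
  have h : ∃ v, HasContinuedValue b σ₀ t₀ v := ⟨v, hv⟩
  rw [continuedValue, dif_pos h]
  exact h.choose_spec.unique hv

/-- The Dirichlet `L`-series `L(χ, s)`, used in its region of absolute convergence. -/
noncomputable def dirichletL {N : ℕ} (χ : DirichletCharacter ℂ N) (s : ℂ) : ℂ :=
  LSeries (fun n => χ n) s

/-- `L(f, s) = ∑ a(n) n^{-s}`, used in its region of absolute convergence. -/
noncomputable def cuspL {N : ℕ} (f : CuspForm2 N) (s : ℂ) : ℂ :=
  LSeries (cuspCoeff f) s

/-- The coefficients `a(n) χ(n)` of `L(f ⊗ χ, t)`. -/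
noncomputable def twistCoeff {N : ℕ} (f : CuspForm2 N) (χ : DirichletCharacter ℂ N) (n : ℕ) : ℂ :=
  cuspCoeff f n * χ n

/-- `σ_t^χ(m) = ∑_{d ∣ m} χ(d) d^t`. -/
noncomputable def sigmaChi {N : ℕ} (χ : DirichletCharacter ℂ N) (t : ℂ) (m : ℕ) : ℂ :=
  ∑ d ∈ m.divisors, χ d * (d : ℂ) ^ t

/-- The coefficient of `l^{-t}` in
`∑_{l ≥ 1, m = l - n ≠ 0} a(l) σ_{2s-1}^χ(|m|) / (l^t |m|^{2s-1})`. -/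
noncomputable def shiftedCoeff {N : ℕ} (f : CuspForm2 N) (χ : DirichletCharacter ℂ N) (n : ℤ)
    (s : ℂ) (l : ℕ) : ℂ :=
  if (l : ℤ) - n = 0 then 0
  else cuspCoeff f l * sigmaChi χ (2 * s - 1) ((l : ℤ) - n).natAbs /
    (((l : ℤ) - n).natAbs : ℂ) ^ (2 * s - 1)

/-- The shifted convolution sum `L(n, χ; s)`: the value at `t = 1` of the analytic continuation of
`∑_{l ≥ 1, m = l - n ≠ 0} a(l) σ_{2s-1}^χ(|m|) / (l^t |m|^{2s-1})`, `Re t > 3/2`. -/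
noncomputable def shiftedConvolution {N : ℕ} (f : CuspForm2 N) (χ : DirichletCharacter ℂ N)
    (n : ℤ) (s : ℂ) : ℂ :=
  continuedValue (shiftedCoeff f χ n s) (3 / 2) 1

/-- `L(f ⊗ χ, t₀)`, by analytic continuation of `∑ a(n) χ(n) n^{-t}`, `Re t > 3/2`. -/
noncomputable def twistL {N : ℕ} (f : CuspForm2 N) (χ : DirichletCharacter ℂ N) (t₀ : ℂ) : ℂ :=
  continuedValue (twistCoeff f χ) (3 / 2) t₀

/-! ### The Eisenstein series formed with modular symbols -/

/-- The modular symbol `⟨f, γ⟩ = ∫_{i∞}^{γ(i∞)} f(w) dw`. For `γ = (a b; c d)` with `c ≠ 0` one has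
`γ(i∞) = a/c`, and the path of integration is the vertical line `w = a/c + iy`; if `c = 0`, then
`γ(i∞) = i∞` and the symbol is `0`. -/
noncomputable def modularSymbol {N : ℕ} (f : CuspForm2 N) (γ : SL(2, ℤ)) : ℂ :=
  if γ 1 0 = 0 then 0
  else -I * ∫ y in Set.Ioi (0 : ℝ), f (ofComplex ((γ 0 0 : ℂ) / (γ 1 0 : ℂ) + y * I))

/-- The stabilizer `Γ_∞` of `∞` in `Γ₀(N)`: the matrices `±(1 *; 0 1)`. -/
def GammaInf (N : ℕ) : Subgroup (CongruenceSubgroup.Gamma0 N) where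
  carrier := {γ | (γ : SL(2, ℤ)) 1 0 = 0}
  one_mem' := by simp
  mul_mem' := by
    intro a b ha hb
    simp only [Set.mem_ofPred_eq] at ha hb ⊢
    simp [Matrix.mul_apply, Fin.sum_univ_two, ha, hb]
  inv_mem' := by
    intro a ha
    simp only [Set.mem_ofPred_eq] at ha ⊢
    simp [Matrix.SpecialLinearGroup.SL2_inv_expl, ha]

/-- The term `conj(χ(γ)) ⟨f, γ⟩ Im(γz)^s`, where `χ(γ) = χ(d)` for `γ = (a b; c d)`. -/
noncomputable def eisensteinTerm {N : ℕ} (f : CuspForm2 N) (χ : DirichletCharacter ℂ N)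
    (s : ℂ) (z : ℍ) (γ : CongruenceSubgroup.Gamma0 N) : ℂ :=
  conj (χ (CongruenceSubgroup.Gamma0Map N γ)) * modularSymbol f γ *
    ((((γ : SL(2, ℤ)) • z).im : ℝ) : ℂ) ^ s

theorem cuspForm_periodic {N : ℕ} (f : CuspForm2 N) :
    Function.Periodic (fun w : ℂ => f (ofComplex w)) (1 : ℂ) := by
  have h1 : (1 : ℝ) ∈ ((CongruenceSubgroup.Gamma0 N).map
      (Matrix.SpecialLinearGroup.mapGL ℝ)).strictPeriods := by
    rw [Subgroup.strictPeriods_eq_zmultiples_one_of_T_mem]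
    · exact AddSubgroup.mem_zmultiples _
    · rw [CongruenceSubgroup.Gamma0_mem]
      simp [ModularGroup.T]
  have := SlashInvariantFormClass.periodic_comp_ofComplex f h1
  simpa using this

/-- The term depends only on the coset `Γ_∞ γ` when `χ(-1) = 1`. -/
theorem eisensteinTerm_congr {N : ℕ} (f : CuspForm2 N) {χ : DirichletCharacter ℂ N}
    (hχ : χ.Even) (s : ℂ) (z : ℍ) (γ δ : CongruenceSubgroup.Gamma0 N)
    (h : QuotientGroup.rightRel (GammaInf N) γ δ) :
    eisensteinTerm f χ s z γ = eisensteinTerm f χ s z δ := by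
  rw [QuotientGroup.rightRel_apply] at h
  obtain ⟨g, hg, rfl⟩ : ∃ g, g ∈ GammaInf N ∧ δ = g * γ := ⟨_, h, by simp⟩
  clear h
  have hc : (g : SL(2, ℤ)) 1 0 = 0 := hg
  have hdet : (g : SL(2, ℤ)) 0 0 * (g : SL(2, ℤ)) 1 1 = 1 := by
    have := (g : SL(2, ℤ)).det_coe
    rw [Matrix.det_fin_two, hc] at this
    simpa using this
  obtain ⟨e, he, ha, hd⟩ : ∃ e : ℤ, (e = 1 ∨ e = -1) ∧ (g : SL(2, ℤ)) 0 0 = e ∧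
      (g : SL(2, ℤ)) 1 1 = e := by
    rcases Int.eq_one_or_neg_one_of_mul_eq_one' hdet with h | h
    · exact ⟨1, Or.inl rfl, h.1, h.2⟩
    · exact ⟨-1, Or.inr rfl, h.1, h.2⟩
  have e00 : ((g * γ : CongruenceSubgroup.Gamma0 N) : SL(2, ℤ)) 0 0 =
      e * (γ : SL(2, ℤ)) 0 0 + (g : SL(2, ℤ)) 0 1 * (γ : SL(2, ℤ)) 1 0 := by
    simp [Matrix.mul_apply, Fin.sum_univ_two, ha]
  have e10 : ((g * γ : CongruenceSubgroup.Gamma0 N) : SL(2, ℤ)) 1 0 = e * (γ : SL(2, ℤ)) 1 0 := by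
    simp [Matrix.mul_apply, Fin.sum_univ_two, hc, hd]
  have e11 : ((g * γ : CongruenceSubgroup.Gamma0 N) : SL(2, ℤ)) 1 1 = e * (γ : SL(2, ℤ)) 1 1 := by
    simp [Matrix.mul_apply, Fin.sum_univ_two, hc, hd]
  have hchi : χ (CongruenceSubgroup.Gamma0Map N (g * γ)) =
      χ (CongruenceSubgroup.Gamma0Map N γ) := by
    have h2 : CongruenceSubgroup.Gamma0Map N g = (e : ZMod N) := by
      simp [CongruenceSubgroup.Gamma0Map, hd]
    rw [map_mul, map_mul, h2]
    rcases he with rfl | rfl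
    · simp
    · have : χ (-1) = 1 := hχ
      simp [this]
  have hsymb : modularSymbol f ((g * γ : CongruenceSubgroup.Gamma0 N) : SL(2, ℤ)) =
      modularSymbol f (γ : SL(2, ℤ)) := by
    have he0 : e ≠ 0 := by rcases he with rfl | rfl <;> norm_num
    unfold modularSymbol
    by_cases h0 : (γ : SL(2, ℤ)) 1 0 = 0
    · rw [if_pos h0, if_pos (by rw [e10, h0, mul_zero])]
    · rw [if_neg h0, if_neg (by rw [e10]; exact mul_ne_zero he0 h0), e10, e00]
      congr 1
      refine MeasureTheory.integral_congr_ae (Filter.Eventually.of_forall fun y => ?_)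
      have hc0 : (((γ : SL(2, ℤ)) 1 0 : ℤ) : ℂ) ≠ 0 := by exact_mod_cast h0
      have key : (((e * (γ : SL(2, ℤ)) 0 0 + (g : SL(2, ℤ)) 0 1 * (γ : SL(2, ℤ)) 1 0 : ℤ) : ℂ) /
          ((e * (γ : SL(2, ℤ)) 1 0 : ℤ) : ℂ) + y * I) =
          (((γ : SL(2, ℤ)) 0 0 : ℂ) / ((γ : SL(2, ℤ)) 1 0 : ℂ) + y * I) +
            ((e * (g : SL(2, ℤ)) 0 1 : ℤ) : ℂ) * 1 := by
        rcases he with rfl | rfl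
        · push_cast
          field_simp
          ring
        · push_cast
          field_simp
          ring
      simp only
      rw [key]
      exact (cuspForm_periodic f).int_mul (e * (g : SL(2, ℤ)) 0 1) _
  have him : (((g * γ : CongruenceSubgroup.Gamma0 N) : SL(2, ℤ)) • z).im =
      ((γ : SL(2, ℤ)) • z).im := by
    rw [ModularGroup.im_smul_eq_div_normSq, ModularGroup.im_smul_eq_div_normSq,
      ModularGroup.denom_apply, ModularGroup.denom_apply, e10, e11]
    rcases he with rfl | rfl
    · simp
    · rw [← Complex.normSq_neg]
      congr 2
      push_cast
      ring
  unfold eisensteinTerm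
  rw [hchi, hsymb, him]

/-- The term attached to a coset in `Γ_∞ \ Γ₀(N)`. -/
noncomputable def eisensteinCosetTerm {N : ℕ} (f : CuspForm2 N) {χ : DirichletCharacter ℂ N}
    (hχ : χ.Even) (s : ℂ) (z : ℍ) (q : Quotient (QuotientGroup.rightRel (GammaInf N))) : ℂ :=
  Quotient.lift (eisensteinTerm f χ s z) (fun γ δ h => eisensteinTerm_congr f hχ s z γ δ h) q

/-- The Eisenstein series formed with modular symbols,
`E*(z, s; χ) = ∑_{γ ∈ Γ_∞ \ Γ₀(N)} conj(χ(γ)) ⟨f, γ⟩ Im(γz)^s`. -/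
noncomputable def eisensteinStar {N : ℕ} (f : CuspForm2 N) {χ : DirichletCharacter ℂ N}
    (hχ : χ.Even) (s : ℂ) (z : ℍ) : ℂ :=
  ∑' q, eisensteinCosetTerm f hχ s z q

/-! ### Fourier expansions -/

/-- The modified Bessel function `K_ν(x) = ∫_0^∞ e^{-x cosh u} cosh(νu) du`, for `x > 0`. -/
noncomputable def besselK (ν : ℂ) (x : ℝ) : ℂ :=
  ∫ u in Set.Ioi (0 : ℝ), ((Real.exp (-x * Real.cosh u) : ℝ) : ℂ) * Complex.cosh (ν * u)

/-- `W_s(nz) = 2 √(|n|y) K_{s-1/2}(2π|n|y) e^{2πinx}`, for `z = x + iy`. -/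
noncomputable def whittakerW (s : ℂ) (n : ℤ) (z : ℍ) : ℂ :=
  2 * ((Real.sqrt (|(n : ℝ)| * z.im) : ℝ) : ℂ) *
    besselK (s - 1 / 2) (2 * Real.pi * |(n : ℝ)| * z.im) *
    Complex.exp (2 * Real.pi * I * n * (z.re : ℂ))

/-- `E(z) = φ(0) y^{1-s} + ∑_{n ≠ 0} φ(n) W_s(nz)` for all `z = x + iy` in the upper half-plane,
with absolute convergence. -/
def HasFourierExpansion (E : ℍ → ℂ) (s : ℂ) (φ : ℤ → ℂ) : Prop :=
  ∀ z : ℍ, HasSum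
    (fun n : ℤ => if n = 0 then φ 0 * (z.im : ℂ) ^ (1 - s) else φ n * whittakerW s n z) (E z)

/-!
Write `e(x) = e^{2πix}`. A coset in `Γ_∞ \ Γ₀(N)` other than the trivial one, on which the symbol
vanishes, is given by a lower row `(c, d + ck)` with `c > 0`, `N ∣ c`, `0 ≤ d < c`, `(c, d) = 1`
and `k ∈ ℤ`. The substitution `w ↦ γ⁻¹w` in the modular symbol yields
`⟨f, γ⟩ = i ∫₀^∞ f(-d/c + iy) dy` (`modularSymbol_eq_integral`), which involves the same `d` as the
character. The sum over `k` is expanded by Poisson summation (`tsum_imPow`), where the Fourier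
transform of `(y / (t² + y²))^s` is a power of `y` at the frequency `0` and a Bessel function
elsewhere. So the `n`-th Fourier coefficient is an elementary factor times the *symbol series*
`S(n) = ∑ χ̄(d) c^{-2s} e(nd/c) ∫₀^∞ f(-d/c + iy) dy` (`hasFourierExpansion_eisensteinCoeff`).
Uniqueness holds because `K_ν` with `Re ν > 0` is not identically zero (`exists_besselK_ne_zero`).

The value of `S(n)` comes from the Mellin transform of
`F(y) = ∑ χ̄(d) c^{-2s} e(nd/c) f(-d/c + iy)`. The transformation law of `f` in weight two gives
`f(-d/c + iy) = O(c²)` uniformly in `y` (`exists_cuspLine_bound_cusp`). For `Re s > 2` the series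
`F` therefore converges and is bounded; it also decays exponentially at `∞`, so its Mellin
transform is holomorphic for `Re t > 0`. At `t = 1` it is `S(n)`, and for `Re t > 3/2` it is, up to
`(2π)^{-t} Γ(t)`, the Dirichlet series with the coefficients `a(l) ∑ χ̄(d) c^{-2s} e((n - l)d/c)`
(`hasContinuedValue_tsum_cuspLine`). The inner sum is the Dirichlet series of the Ramanujan sums
twisted by `χ̄`, which equals `W(χ̄) N^{-2s} σ^χ_{2s-1}(|n - l|) |n - l|^{1-2s} / L(χ̄, 2s)` for
`l ≠ n` (`dirichletL_mul_LSeries_charSum`). The term `l = n` vanishes, since it contains the sum of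
a nontrivial character, except for `N = 1`, where there are no cusp forms of weight two. This
evaluates `S(n)` as a shifted convolution sum for `n ≠ 0`. The same principle, applied to the
finitely many points `-u/N`, continues `L(f ⊗ χ, t)`.

For `n = 0` the coefficients are multiples of `a(l) σ^χ_{2s-1}(l) l^{1-2s}`. If `f` is a normalized
eigenform, then `a(d) a(e) = ∑ g a(de/g²)` over `g ∣ (d, e)`, for all `d` prime to `N`
(`HeckeRelations.mul_eq`). Summing this against `χ(d) d^{-t} e^{1-2s-t}` gives
`L(f ⊗ χ, t) L(f, t + 2s - 1) = L(χ, 2t + 2s - 2) ∑ a(l) σ^χ_{2s-1}(l) l^{1-2s-t}`, and `t = 1`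
gives the constant term.
-/

open scoped Real Topology
open Filter MeasureTheory Asymptotics

/-! ### Cusp forms of weight two along vertical lines -/

/-- The values `f(x + iy)` of a cusp form in real coordinates. -/
noncomputable def cuspLine {N : ℕ} (f : CuspForm2 N) (x y : ℝ) : ℂ :=
  f (ofComplex (x + y * I))

theorem one_mem_strictPeriods_Gamma0 (N : ℕ) : (1 : ℝ) ∈ ((CongruenceSubgroup.Gamma0 N).map
    (Matrix.SpecialLinearGroup.mapGL ℝ)).strictPeriods := by
  rw [CongruenceSubgroup.strictPeriods_Gamma0]
  exact AddSubgroup.mem_zmultiples _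

theorem cuspCoeff_zero {N : ℕ} (f : CuspForm2 N) : cuspCoeff f 0 = 0 :=
  CuspFormClass.qExpansion_coeff_zero f one_pos (one_mem_strictPeriods_Gamma0 N)

theorem ofComplex_mk {x y : ℝ} (hy : 0 < y) :
    ofComplex (x + y * I) = ⟨x + y * I, by simpa using hy⟩ :=
  ofComplex_apply_of_im_pos (by simpa using hy)

theorem hasSum_cuspLine {N : ℕ} [NeZero N] (f : CuspForm2 N) (x : ℝ) {y : ℝ} (hy : 0 < y) :
    HasSum (fun l : ℕ => cuspCoeff f l * cexp (2 * π * I * l * x) * (Real.exp (-(2 * π * l) * y) : ℝ))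
      (cuspLine f x y) := by
  have h := ModularForm.hasSum_qExpansion f one_pos (one_mem_strictPeriods_Gamma0 N)
    (ofComplex (x + y * I))
  refine h.congr_fun fun l => ?_
  rw [cuspCoeff, mul_assoc, ofComplex_mk hy, Function.Periodic.qParam, ← Complex.exp_nat_mul,
    ofReal_exp, ← Complex.exp_add]
  congr 2
  push_cast
  linear_combination -(2 * π * l * y : ℂ) * I_sq

theorem continuousOn_cuspLine {N : ℕ} (f : CuspForm2 N) (x : ℝ) :
    ContinuousOn (cuspLine f x) (Set.Ioi 0) := by
  have hf : Continuous f := (CuspFormClass.holo f).continuous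
  intro y hy
  refine ContinuousAt.continuousWithinAt ?_
  have h1 : ContinuousAt (fun w : ℂ => f (ofComplex w)) (x + y * I) :=
    hf.continuousAt.comp (contMDiffAt_ofComplex (n := 0) (by simpa using hy)).continuousAt
  exact ContinuousAt.comp (f := fun y : ℝ => (x + y * I : ℂ)) h1 (by fun_prop)

/-- A cusp form of weight two is `O(1/y)` everywhere and decays exponentially at `i∞`,
both uniformly in `x`. -/
theorem exists_cuspLine_bound {N : ℕ} [NeZero N] (f : CuspForm2 N) :
    ∃ C : ℝ, 0 < C ∧ ∀ x y : ℝ, 0 < y → ‖cuspLine f x y‖ ≤ C / y ∧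
      (1 ≤ y → ‖cuspLine f x y‖ ≤ C * Real.exp (-(2 * π) * y)) := by
  obtain ⟨C₁, h₁⟩ := CuspFormClass.exists_bound f
  have h₁' : ∀ x y : ℝ, 0 < y → ‖cuspLine f x y‖ ≤ (|C₁| + 1) / y := by
    intro x y hy
    have := h₁ (ofComplex (x + y * I))
    have him : (ofComplex (x + y * I)).im = y := by rw [ofComplex_mk hy]; simp [UpperHalfPlane.im]
    rw [him] at this
    norm_num at this
    refine this.trans ?_
    gcongr
    linarith [le_abs_self C₁]
  have h₂ := CuspFormClass.exp_decay_atImInfty f one_pos (one_mem_strictPeriods_Gamma0 N)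
  obtain ⟨C₂, h₂⟩ := h₂.bound
  rw [UpperHalfPlane.atImInfty, Filter.eventually_comap, Filter.eventually_atTop] at h₂
  obtain ⟨A, hA⟩ := h₂
  have hexp : ∀ u : ℝ, 0 ≤ u → 1 ≤ Real.exp (2 * π * u) := fun u hu => Real.one_le_exp (by positivity)
  have hE := hexp |A| (abs_nonneg A)
  refine ⟨(|C₁| + 1) * Real.exp (2 * π * |A|) + |C₂|, by positivity, fun x y hy => ⟨?_, ?_⟩⟩
  · refine (h₁' x y hy).trans (div_le_div_of_nonneg_right ?_ hy.le)
    nlinarith [abs_nonneg C₁, abs_nonneg C₂]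
  · intro hy1
    rcases le_total A y with hAy | hAy
    · have := hA y hAy (ofComplex (x + y * I)) (by rw [ofComplex_mk hy]; simp [UpperHalfPlane.im])
      have him : (ofComplex (x + y * I)).im = y := by rw [ofComplex_mk hy]; simp [UpperHalfPlane.im]
      rw [him, Real.norm_eq_abs, Real.abs_exp] at this
      rw [show -(2 * π) * y = -2 * π * y / 1 by ring]
      refine this.trans ?_
      gcongr
      have : 0 ≤ (|C₁| + 1) * Real.exp (2 * π * |A|) := by positivity
      linarith [le_abs_self C₂]
    · have h3 : (|C₁| + 1) / y ≤ (|C₁| + 1) := div_le_self (by positivity) hy1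
      have h4 : (|C₁| + 1) ≤ (|C₁| + 1) * Real.exp (2 * π * |A|) * Real.exp (-(2 * π) * y) := by
        rw [mul_assoc, ← Real.exp_add]
        refine le_mul_of_one_le_right (by positivity) (Real.one_le_exp ?_)
        nlinarith [le_abs_self A, Real.pi_pos]
      refine (h₁' x y hy).trans (h3.trans (h4.trans ?_))
      gcongr
      linarith [abs_nonneg C₂]

/-- Since `1/y ≤ 1/y²` for `y ≤ 1`, and `f` decays exponentially, `f(x + iy)` is `O(1/y²)`. This is
the form of the bound that the inversion `y ↦ 1/(c²y)` turns into boundedness at a cusp. -/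
theorem exists_cuspLine_bound_sq {N : ℕ} [NeZero N] (f : CuspForm2 N) :
    ∃ C : ℝ, 0 < C ∧ ∀ x y : ℝ, 0 < y → ‖cuspLine f x y‖ ≤ C / y ^ 2 := by
  obtain ⟨C, hC, h⟩ := exists_cuspLine_bound f
  refine ⟨C, hC, fun x y hy => ?_⟩
  obtain ⟨h1, h2⟩ := h x y hy
  rcases le_total 1 y with hy1 | hy1
  · refine (h2 hy1).trans ?_
    rw [div_eq_mul_inv]
    gcongr
    rw [show -(2 * π) * y = -(2 * π * y) by ring, Real.exp_neg]
    gcongr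
    have h3 := Real.quadratic_le_exp_of_nonneg (x := 2 * π * y) (by positivity)
    have : 3 * y ≤ π * y := by gcongr; exact Real.pi_gt_three.le
    nlinarith
  · refine h1.trans ?_
    gcongr
    nlinarith

/-- The transformation law of `f` under `γ = (a b; c d)`, along the vertical line that ends in
`-d/c = γ⁻¹(i∞)`. -/
theorem cuspLine_transform {N : ℕ} (f : CuspForm2 N) (γ : CongruenceSubgroup.Gamma0 N)
    (hc : 0 < (γ : SL(2, ℤ)) 1 0) {y : ℝ} (hy : 0 < y) :
    cuspLine f (-((γ : SL(2, ℤ)) 1 1 / (γ : SL(2, ℤ)) 1 0)) y =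
      -((((γ : SL(2, ℤ)) 1 0 : ℂ) * y) ^ 2)⁻¹ *
        cuspLine f ((γ : SL(2, ℤ)) 0 0 / (γ : SL(2, ℤ)) 1 0)
          ((((γ : SL(2, ℤ)) 1 0 : ℝ) ^ 2 * y)⁻¹) := by
  set a := (γ : SL(2, ℤ)) 0 0 with ha
  set b := (γ : SL(2, ℤ)) 0 1 with hb
  set c := (γ : SL(2, ℤ)) 1 0 with hcdef
  set d := (γ : SL(2, ℤ)) 1 1 with hd
  have hc' : (0 : ℝ) < c := by exact_mod_cast hc
  have hcC : (c : ℂ) ≠ 0 := by exact_mod_cast hc.ne'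
  have hyC : (y : ℂ) ≠ 0 := by exact_mod_cast hy.ne'
  have hdet : (a : ℂ) * d - b * c = 1 := by
    have := (γ : SL(2, ℤ)).det_coe
    rw [Matrix.det_fin_two] at this
    exact_mod_cast this
  have hy' : 0 < (((c : ℝ) ^ 2 * y)⁻¹) := by positivity
  have h := SlashInvariantForm.slash_action_eqn' (f := f) (k := 2)
    (Γ := (CongruenceSubgroup.Gamma0 N).map (Matrix.SpecialLinearGroup.mapGL ℝ))
    (γ := Matrix.SpecialLinearGroup.mapGL ℝ (γ : SL(2, ℤ))) (Subgroup.mem_map_of_mem _ γ.2)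
    (ofComplex ((-(d / c) : ℝ) + y * I))
  have hz : ((ofComplex ((-(d / c) : ℝ) + y * I) : ℍ) : ℂ) = -(d / c) + y * I := by
    rw [ofComplex_mk hy]; simp
  have hden : (c : ℂ) * (-(d / c) + y * I) + d = c * y * I := by field_simp; ring
  have hsm : Matrix.SpecialLinearGroup.mapGL ℝ (γ : SL(2, ℤ)) • ofComplex ((-(d / c) : ℝ) + y * I)
      = ofComplex ((a / c : ℝ) + ((((c : ℝ) ^ 2 * y)⁻¹ : ℝ) : ℂ) * I) := by
    apply UpperHalfPlane.ext
    change (((γ : SL(2, ℤ)) • ofComplex ((-(d / c) : ℝ) + y * I) : ℍ) : ℂ) = _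
    rw [UpperHalfPlane.coe_specialLinearGroup_apply, hz, ofComplex_mk hy']
    simp only [← ha, ← hb, ← hcdef, ← hd, algebraMap_int_eq, eq_intCast, ofReal_intCast]
    rw [hden]
    push_cast
    have : (a : ℂ) * d = 1 + b * c := by linear_combination hdet
    field_simp
    ring_nf
    rw [I_sq]
    linear_combination -this
  rw [hsm, hz] at h
  simp only [Matrix.SpecialLinearGroup.mapGL_coe_matrix, Matrix.SpecialLinearGroup.map_apply_coe,
    RingHom.mapMatrix_apply, Matrix.map_apply, ← hcdef, ← hd, algebraMap_int_eq, eq_intCast,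
    ofReal_intCast, hden] at h
  rw [cuspLine, cuspLine, h]
  have h2 : ((c : ℂ) * y * I) ^ (2 : ℤ) = -((c : ℂ) * y) ^ 2 := by
    norm_cast
    rw [mul_pow, I_sq]; push_cast; ring
  rw [h2]
  field_simp

/-- Near a cusp `-d/c` equivalent to `i∞`, a cusp form of weight two is bounded along the vertical
line, polynomially in `c`. -/
theorem exists_cuspLine_bound_cusp {N : ℕ} [NeZero N] (f : CuspForm2 N) :
    ∃ C : ℝ, 0 < C ∧ ∀ γ : CongruenceSubgroup.Gamma0 N, 0 < (γ : SL(2, ℤ)) 1 0 → ∀ y : ℝ, 0 < y →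
      ‖cuspLine f (-((γ : SL(2, ℤ)) 1 1 / (γ : SL(2, ℤ)) 1 0)) y‖ ≤
        C * ((γ : SL(2, ℤ)) 1 0 : ℝ) ^ 2 := by
  obtain ⟨C, hC, h⟩ := exists_cuspLine_bound_sq f
  refine ⟨C, hC, fun γ hc y hy => ?_⟩
  have hc' : (0 : ℝ) < (γ : SL(2, ℤ)) 1 0 := by exact_mod_cast hc
  rw [cuspLine_transform f γ hc hy, norm_mul, norm_neg, norm_inv, norm_pow, norm_mul]
  refine (mul_le_mul_of_nonneg_left (h _ _ (by positivity)) (by positivity)).trans_eq ?_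
  rw [Complex.norm_intCast, abs_of_pos hc', Complex.norm_of_nonneg hy.le]
  field_simp

/-- The modular symbol as an integral along the vertical line above `γ⁻¹(i∞) = -d/c`. -/
theorem modularSymbol_eq_integral {N : ℕ} (f : CuspForm2 N) (γ : CongruenceSubgroup.Gamma0 N)
    (hc : 0 < (γ : SL(2, ℤ)) 1 0) :
    modularSymbol f (γ : SL(2, ℤ)) =
      I * ∫ y in Set.Ioi (0 : ℝ),
        cuspLine f (-((γ : SL(2, ℤ)) 1 1 / (γ : SL(2, ℤ)) 1 0)) y := by
  -- the substitution `y ↦ 1/(c²y)` is carried out on Mellin transforms at the point `1`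
  have hmain : ∀ g : ℝ → ℂ, ∫ y in Set.Ioi (0 : ℝ), g y = mellin g 1 := by
    intro g; simp [mellin]
  set c := (γ : SL(2, ℤ)) 1 0 with hcdef
  set h := cuspLine f ((γ : SL(2, ℤ)) 0 0 / c) with hh
  have hc' : (0 : ℝ) < c := by exact_mod_cast hc
  have hcC : (c : ℂ) ≠ 0 := by exact_mod_cast hc.ne'
  have e1 : ∫ y in Set.Ioi (0 : ℝ), cuspLine f (-((γ : SL(2, ℤ)) 1 1 / c)) y =
      ∫ y in Set.Ioi (0 : ℝ), (-((c : ℂ) ^ 2)⁻¹) • ((y : ℂ) ^ (-2 : ℂ) •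
        (fun u => h u⁻¹) ((c : ℝ) ^ 2 * y)) := by
    refine setIntegral_congr_fun measurableSet_Ioi fun y hy => ?_
    have hy : 0 < y := hy
    simp only [smul_eq_mul]
    rw [cuspLine_transform f γ hc hy, ← hcdef, ← hh, cpow_neg, cpow_ofNat]
    field_simp
  rw [e1, integral_smul, hmain, mellin_cpow_smul, mellin_comp_mul_left (fun u => h u⁻¹) _ (by positivity),
    mellin_comp_inv, modularSymbol, if_neg hc.ne']
  have e2 : ∫ y in Set.Ioi (0 : ℝ), f (ofComplex (((γ : SL(2, ℤ)) 0 0 : ℂ) / (c : ℂ) + y * I)) =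
      mellin h 1 := by
    rw [← hmain, hh]
    refine setIntegral_congr_fun measurableSet_Ioi fun y hy => ?_
    simp [cuspLine]
  rw [e2]
  norm_num
  field_simp

/-- There are no cusp forms of weight two and level one. -/
theorem cuspForm_level_one_eq_zero (f : CuspForm2 1) : f = 0 := by
  have hΓ : (CongruenceSubgroup.Gamma0 1).map (Matrix.SpecialLinearGroup.mapGL ℝ) =
      (Matrix.SpecialLinearGroup.mapGL ℝ : SL(2, ℤ) →* GL (Fin 2) ℝ).range := by
    rw [MonoidHom.range_eq_map]
    congr 1
    ext γ
    simp only [CongruenceSubgroup.Gamma0_mem, Subgroup.mem_top, iff_true]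
    exact Subsingleton.elim _ _
  have key : ∀ Γ : Subgroup (GL (Fin 2) ℝ),
      Γ = (Matrix.SpecialLinearGroup.mapGL ℝ : SL(2, ℤ) →* GL (Fin 2) ℝ).range →
      ∀ g : CuspForm Γ 2, g = 0 := by
    rintro _ rfl g
    exact rank_zero_iff_forall_zero.mp
      (CuspForm.rank_eq_zero_of_weight_lt_twelve (by norm_num)) g
  exact key _ hΓ f

/-! ### Trigonometric series and the average size of Fourier coefficients -/

section Fourier

variable {ι : Type*} {c : ι → ℂ} {k : ι → ℤ}

/-- The sum of an absolutely convergent trigonometric series, as a function on `ℝ/ℤ`. -/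
noncomputable def trigSeries (c : ι → ℂ) (k : ι → ℤ) : C(UnitAddCircle, ℂ) :=
  ∑' i, c i • fourier (k i)

theorem hasSum_trigSeries (hc : Summable c) (k : ι → ℤ) :
    HasSum (fun i => c i • (fourier (k i) : C(UnitAddCircle, ℂ))) (trigSeries c k) := by
  refine Summable.hasSum (Summable.of_norm ?_)
  simpa [norm_smul, fourier_norm] using hc.norm

theorem hasSum_trigSeries_apply (hc : Summable c) (k : ι → ℤ) (x : ℝ) :
    HasSum (fun i => c i * cexp (2 * π * I * k i * x)) (trigSeries c k (x : UnitAddCircle)) := by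
  have h := ContinuousMap.hasSum_apply (hasSum_trigSeries hc k) (x : UnitAddCircle)
  refine h.congr_fun fun i => ?_
  simp

/-- The coefficients are recovered by integrating term by term. -/
theorem fourierCoeff_trigSeries [Countable ι] (hc : Summable c) (hk : Function.Injective k)
    (j : ι) : fourierCoeff (trigSeries c k) (k j) = c j := by
  classical
  have h1 : ∀ x : UnitAddCircle, HasSum (fun i => c i * (fourier (k i) x)) (trigSeries c k x) :=
    fun x => by simpa using ContinuousMap.hasSum_apply (hasSum_trigSeries hc k) x
  rw [fourierCoeff]
  have h2 : ∀ x : UnitAddCircle, (fourier (-k j) x • trigSeries c k x : ℂ) =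
      ∑' i, fourier (-k j) x * (c i * fourier (k i) x) := fun x => by
    rw [smul_eq_mul, ← (h1 x).tsum_eq, tsum_mul_left]
  simp_rw [h2]
  rw [← integral_tsum_of_summable_integral_norm]
  · have h3 : ∀ i, ∫ x : UnitAddCircle, fourier (-k j) x * (c i * fourier (k i) x)
        ∂AddCircle.haarAddCircle =
        if i = j then c j else 0 := by
      intro i
      have := congr_fun (fourierCoeff_fourier (T := 1) (k i)) (k j)
      rw [fourierCoeff] at this
      simp_rw [mul_left_comm, integral_const_mul]
      simp only [smul_eq_mul] at this
      rw [this, Pi.single_apply]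
      by_cases hij : i = j
      · simp [hij]
      · simp [hij, hk.ne (Ne.symm hij)]
    simp_rw [h3]
    simp
  · intro i
    exact Continuous.integrable_of_hasCompactSupport (by fun_prop)
      (HasCompactSupport.of_compactSpace _)
  · have h4 : ∀ n, ∀ x : UnitAddCircle, ‖(fourier n x : ℂ)‖ = 1 := fun n x => by
      rw [fourier_apply, Circle.norm_coe]
    simpa only [norm_mul, h4, one_mul, mul_one, integral_const, probReal_univ, one_smul] using hc.norm

theorem trigSeries_unique [Countable ι] (hc : Summable c) (hk : Function.Injective k)
    (h : ∀ x : ℝ, HasSum (fun i => c i * cexp (2 * π * I * k i * x)) 0) (j : ι) : c j = 0 := by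
  have h0 : trigSeries c k = 0 := by
    ext x
    induction x using QuotientAddGroup.induction_on with
    | H x => exact (hasSum_trigSeries_apply hc k x).unique (h x)
  rw [← fourierCoeff_trigSeries hc hk j, h0]
  simp [fourierCoeff]

/-- Bessel's inequality for an absolutely convergent trigonometric series bounded by `M`. -/
theorem trigSeries_bessel [Countable ι] (hc : Summable c) (hk : Function.Injective k) {g : ℝ → ℂ}
    (h : ∀ x : ℝ, HasSum (fun i => c i * cexp (2 * π * I * k i * x)) (g x)) {M : ℝ}
    (hM : ∀ x, ‖g x‖ ≤ M) (S : Finset ι) : ∑ i ∈ S, ‖c i‖ ^ 2 ≤ M ^ 2 := by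
  classical
  have hb : ∀ x : UnitAddCircle, ‖trigSeries c k x‖ ≤ M := by
    intro x
    induction x using QuotientAddGroup.induction_on with
    | H x =>
      have := (hasSum_trigSeries_apply hc k x).unique (h x)
      exact this ▸ hM x
  set G := ContinuousMap.toLp (E := ℂ) 2 AddCircle.haarAddCircle ℂ (trigSeries c k) with hG
  have h1 := hasSum_sq_fourierCoeff G
  have h2 : ∀ n, fourierCoeff G n = fourierCoeff (trigSeries c k) n := fourierCoeff_toLp _
  have h3 := sum_le_hasSum (S.image k) (fun _ _ => by positivity) h1
  rw [Finset.sum_image hk.injOn] at h3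
  simp_rw [h2, fourierCoeff_trigSeries hc hk] at h3
  refine h3.trans ?_
  have h4 : ∫ t, ‖G t‖ ^ 2 ∂AddCircle.haarAddCircle =
      ∫ t, ‖trigSeries c k t‖ ^ 2 ∂(AddCircle.haarAddCircle (T := 1)) := by
    refine integral_congr_ae ?_
    filter_upwards [ContinuousMap.coeFn_toLp (𝕜 := ℂ) (p := 2) AddCircle.haarAddCircle
      (trigSeries c k)] with t ht
    rw [hG, ht]
  rw [h4]
  have h5 : ∫ t, ‖trigSeries c k t‖ ^ 2 ∂(AddCircle.haarAddCircle (T := 1)) ≤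
      ∫ _, M ^ 2 ∂(AddCircle.haarAddCircle (T := 1)) := by
    refine integral_mono_of_nonneg (Eventually.of_forall fun _ => by positivity)
      (integrable_const _) (Eventually.of_forall fun t => ?_)
    exact pow_le_pow_left₀ (norm_nonneg _) (hb t) 2
  simpa using h5

end Fourier

/-- The average size of the Fourier coefficients, from Bessel's inequality at height `1/n` and the
Cauchy–Schwarz inequality. -/
theorem exists_sum_norm_cuspCoeff_le {N : ℕ} [NeZero N] (f : CuspForm2 N) :
    ∃ C : ℝ, ∀ n : ℕ, ∑ l ∈ Finset.Icc 1 n, ‖cuspCoeff f l‖ ≤ C * (n : ℝ) ^ (3 / 2 : ℝ) := by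
  obtain ⟨C, hC, h⟩ := exists_cuspLine_bound f
  refine ⟨C * Real.exp (2 * π), fun n => ?_⟩
  rcases Nat.eq_zero_or_pos n with rfl | hn
  · simp
  have hn' : (0 : ℝ) < n := by exact_mod_cast hn
  have hy : (0 : ℝ) < (n : ℝ)⁻¹ := by positivity
  have hs : Summable fun l : ℕ => cuspCoeff f l * (Real.exp (-(2 * π * l) * (n : ℝ)⁻¹) : ℝ) := by
    simpa using (hasSum_cuspLine f 0 hy).summable
  have hb := trigSeries_bessel (k := fun l : ℕ => (l : ℤ)) hs Nat.cast_injective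
    (g := fun x => cuspLine f x (n : ℝ)⁻¹) (fun x => (hasSum_cuspLine f x hy).congr_fun
      fun l => by push_cast; ring) (M := C * n)
    (fun x => by simpa using (h x _ hy).1) (Finset.Icc 1 n)
  have h1 : ∑ l ∈ Finset.Icc 1 n, ‖cuspCoeff f l‖ ^ 2 ≤ (C * n * Real.exp (2 * π)) ^ 2 := by
    rw [mul_pow (C * n)]
    refine le_trans ?_ (mul_le_mul_of_nonneg_right hb (by positivity))
    rw [Finset.sum_mul]
    refine Finset.sum_le_sum fun l hl => ?_
    rw [← mul_pow, norm_mul, Complex.norm_of_nonneg (Real.exp_nonneg _), mul_assoc, ← Real.exp_add]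
    refine pow_le_pow_left₀ (norm_nonneg _) (le_mul_of_one_le_right (norm_nonneg _)
      (Real.one_le_exp ?_)) 2
    have : (l : ℝ) * (n : ℝ)⁻¹ ≤ 1 := by
      rw [← div_eq_mul_inv, div_le_one hn']; exact_mod_cast (Finset.mem_Icc.mp hl).2
    nlinarith [Real.pi_pos]
  have h2 := sq_sum_le_card_mul_sum_sq (s := Finset.Icc 1 n) (f := fun l => ‖cuspCoeff f l‖)
  rw [Nat.card_Icc, Nat.add_sub_cancel] at h2
  refine abs_le_of_sq_le_sq' ?_ (by positivity) |>.2
  refine h2.trans ((mul_le_mul_of_nonneg_left h1 hn'.le).trans_eq ?_)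
  rw [mul_pow _ ((n : ℝ) ^ (3 / 2 : ℝ)), ← Real.rpow_natCast ((n : ℝ) ^ (3 / 2 : ℝ)),
    ← Real.rpow_mul hn'.le]
  norm_num
  ring

/-- Absolute convergence for `Re t > 3/2`, by partial summation from the average bound. -/
theorem LSeriesSummable_cuspCoeff {N : ℕ} [NeZero N] (f : CuspForm2 N) {t : ℂ}
    (ht : 3 / 2 < t.re) : LSeriesSummable (cuspCoeff f) t := by
  obtain ⟨C, hC⟩ := exists_sum_norm_cuspCoeff_le f
  refine LSeriesSummable_of_sum_norm_bigO (IsBigO.of_bound C (Eventually.of_forall fun n => ?_))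
    (by norm_num) ht
  rw [Real.norm_of_nonneg (by positivity), Real.norm_of_nonneg (by positivity)]
  exact hC n

/-! ### Analytic continuation by Mellin transforms -/

/-- A bound `M` for `f` along a vertical line controls the integral over `y ≤ 1`; the rest of the
integral is bounded by the exponential decay at `i∞`, uniformly in `x`. -/
theorem exists_integral_norm_cuspLine_le {N : ℕ} [NeZero N] (f : CuspForm2 N) :
    ∃ C : ℝ, 0 < C ∧ ∀ x M : ℝ, (∀ y : ℝ, 0 < y → ‖cuspLine f x y‖ ≤ M) →
      IntegrableOn (cuspLine f x) (Set.Ioi 0) ∧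
      ∫ y in Set.Ioi (0 : ℝ), ‖cuspLine f x y‖ ≤ M + C := by
  obtain ⟨C, hC, h⟩ := exists_cuspLine_bound f
  refine ⟨C, hC, fun x M hM => ?_⟩
  have hM0 : 0 ≤ M := (norm_nonneg _).trans (hM 1 one_pos)
  set g : ℝ → ℝ := fun y => (Set.Ioc (0 : ℝ) 1).indicator (fun _ => M) y +
    C * Real.exp (-(2 * π) * y) with hg
  have hi1 : IntegrableOn ((Set.Ioc (0 : ℝ) 1).indicator (fun _ => M)) (Set.Ioi 0) :=
    Integrable.integrableOn ((integrable_indicator_iff measurableSet_Ioc).mpr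
      (by simp))
  have hi2 : IntegrableOn (fun y : ℝ => C * Real.exp (-(2 * π) * y)) (Set.Ioi 0) :=
    (exp_neg_integrableOn_Ioi 0 (by positivity)).const_mul C
  have hgi : IntegrableOn g (Set.Ioi 0) := hi1.add hi2
  have hle : ∀ y ∈ Set.Ioi (0 : ℝ), ‖cuspLine f x y‖ ≤ g y := by
    intro y hy
    have hy : 0 < y := hy
    rcases le_total y 1 with hy1 | hy1
    · rw [hg]
      simp only [Set.indicator_of_mem (show y ∈ Set.Ioc (0 : ℝ) 1 from ⟨hy, hy1⟩)]
      have : 0 ≤ C * Real.exp (-(2 * π) * y) := by positivity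
      linarith [hM y hy]
    · refine ((h x y hy).2 hy1).trans (le_add_of_nonneg_left ?_)
      exact Set.indicator_nonneg (fun _ _ => hM0) _
  have hae : ∀ᵐ y ∂(volume.restrict (Set.Ioi (0 : ℝ))), ‖cuspLine f x y‖ ≤ g y :=
    (ae_restrict_iff' measurableSet_Ioi).mpr (Eventually.of_forall hle)
  have hint : IntegrableOn (cuspLine f x) (Set.Ioi 0) :=
    Integrable.mono' hgi ((continuousOn_cuspLine f x).aestronglyMeasurable measurableSet_Ioi) hae
  refine ⟨hint, (integral_mono_ae hint.norm hgi hae).trans ?_⟩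
  rw [hg, integral_add hi1 hi2, integral_const_mul, integral_exp_mul_Ioi
    (by linarith [Real.pi_pos] : -(2 * π) < 0)]
  refine add_le_add ?_ ?_
  · rw [setIntegral_indicator measurableSet_Ioc,
      Set.inter_eq_right.mpr Set.Ioc_subset_Ioi_self]
    simp
  · rw [mul_zero, Real.exp_zero, neg_div_neg_eq, mul_one_div, div_le_iff₀ (by positivity)]
    nlinarith [Real.pi_gt_three]

section Mellin

variable {N : ℕ} [NeZero N] (f : CuspForm2 N) {ι : Type*} {w : ι → ℂ} {x M : ι → ℝ}

theorem summable_norm_of_mul_bound (hM1 : ∀ i, 1 ≤ M i) (hw : Summable fun i => ‖w i‖ * M i) :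
    Summable fun i => ‖w i‖ :=
  hw.of_nonneg_of_le (fun _ => norm_nonneg _)
    fun i => le_mul_of_one_le_right (norm_nonneg _) (hM1 i)

/-- The `q`-expansion of a superposition of horizontal translates. -/
theorem hasSum_tsum_cuspLine (hw : Summable fun i => ‖w i‖) (x : ι → ℝ) {y : ℝ} (hy : 0 < y) :
    HasSum (fun l : ℕ => cuspCoeff f l * (∑' i, w i * cexp (2 * π * I * l * x i)) *
      (Real.exp (-(2 * π * l) * y) : ℝ)) (∑' i, w i * cuspLine f (x i) y) := by
  set u : ι × ℕ → ℂ := fun p => w p.1 * (cuspCoeff f p.2 * cexp (2 * π * I * p.2 * x p.1) *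
    (Real.exp (-(2 * π * p.2) * y) : ℝ)) with hu
  have hnorm : ∀ (l : ℕ) (r : ℝ), ‖cexp (2 * π * I * l * r)‖ = 1 := fun l r => by
    rw [show (2 * π * I * l * r : ℂ) = ((2 * π * l * r : ℝ) : ℂ) * I by push_cast; ring,
      norm_exp_ofReal_mul_I]
  have hus : Summable u := by
    refine Summable.of_norm ?_
    have h0 : Summable fun l : ℕ => ‖cuspCoeff f l * (Real.exp (-(2 * π * l) * y) : ℝ)‖ := by
      have := (hasSum_cuspLine f 0 hy).summable.norm
      simpa using this
    have := hw.mul_of_nonneg h0 (fun _ => norm_nonneg _) (fun _ => norm_nonneg _)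
    refine this.congr fun p => ?_
    simp only [hu, norm_mul, hnorm, mul_one]
  have h1 : HasSum (fun i => w i * cuspLine f (x i) y) (∑' p, u p) :=
    hus.hasSum.prod_fiberwise fun i => (hasSum_cuspLine f (x i) hy).mul_left (w i)
  have h2 := (Equiv.prodComm ℕ ι).hasSum_iff.mpr hus.hasSum
  rw [h1.tsum_eq]
  refine h2.prod_fiberwise fun l => ?_
  have h3 : Summable fun i => w i * cexp (2 * π * I * l * x i) := by
    refine Summable.of_norm (hw.congr fun i => ?_)
    rw [norm_mul, hnorm, mul_one]
  have h4 := (h3.hasSum.mul_left (cuspCoeff f l)).mul_right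
    ((Real.exp (-(2 * π * l) * y) : ℝ) : ℂ)
  refine h4.congr_fun fun i => ?_
  simp only [Function.comp, hu, Equiv.prodComm_apply, Prod.swap]
  ring

/-- If `f` is bounded on the vertical lines above the points `x i`, with bounds that are summable
against the weights `w i`, then the Mellin transform of `F(y) = ∑ w i f(x i + iy)` is holomorphic
for `Re t > 0`, since `F` is bounded at `0` and decays exponentially at `∞`. It continues the
Dirichlet series with coefficients `a(l) ∑ w i e(l x i)`. -/
theorem hasContinuedValue_tsum_cuspLine [Countable ι] (hM1 : ∀ i, 1 ≤ M i)
    (hM : ∀ i (y : ℝ), 0 < y → ‖cuspLine f (x i) y‖ ≤ M i)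
    (hw : Summable fun i => ‖w i‖ * M i) :
    HasContinuedValue (fun l => cuspCoeff f l * ∑' i, w i * cexp (2 * π * I * l * x i)) (3 / 2) 1
      (2 * π * ∑' i, w i * ∫ y in Set.Ioi (0 : ℝ), cuspLine f (x i) y) := by
  have hw0 := summable_norm_of_mul_bound hM1 hw
  set F : ℝ → ℂ := fun y => ∑' i, w i * cuspLine f (x i) y with hF
  obtain ⟨C, hC, hb⟩ := exists_cuspLine_bound f
  have hcont : ContinuousOn F (Set.Ioi 0) := by
    refine continuousOn_tsum (fun i => (continuousOn_cuspLine f (x i)).const_mul (w i)) hw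
      fun i y hy => ?_
    rw [norm_mul]
    exact mul_le_mul_of_nonneg_left (hM i y hy) (norm_nonneg _)
  have hloc : LocallyIntegrableOn F (Set.Ioi 0) := hcont.locallyIntegrableOn measurableSet_Ioi
  have htop : F =O[atTop] fun y => Real.exp (-(2 * π) * y) := by
    refine IsBigO.of_bound (∑' i, ‖w i‖ * C) ?_
    filter_upwards [eventually_ge_atTop 1] with y hy
    rw [Real.norm_of_nonneg (Real.exp_nonneg _), ← tsum_mul_right]
    refine tsum_of_norm_bounded ((hw0.mul_right C).mul_right _).hasSum fun i => ?_
    rw [norm_mul, mul_assoc]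
    exact mul_le_mul_of_nonneg_left ((hb (x i) y (by linarith)).2 hy) (norm_nonneg _)
  have hbot : F =O[𝓝[>] 0] fun y => y ^ (-0 : ℝ) := by
    refine IsBigO.of_bound (∑' i, ‖w i‖ * M i) ?_
    filter_upwards [self_mem_nhdsWithin] with y hy
    rw [neg_zero, Real.rpow_zero, norm_one, mul_one]
    refine tsum_of_norm_bounded hw.hasSum fun i => ?_
    rw [norm_mul]
    exact mul_le_mul_of_nonneg_left (hM i y hy) (norm_nonneg _)
  have hpi : ((2 * π : ℝ) : ℂ) ≠ 0 := by exact_mod_cast Real.two_pi_pos.ne'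
  refine ⟨0, by simp, fun t => ((2 * π : ℝ) : ℂ) ^ t * (Gamma t)⁻¹ * mellin F t, ?_, ?_, ?_⟩
  · intro t ht
    have h1 : DifferentiableAt ℂ (mellin F) t :=
      mellin_differentiableAt_of_isBigO_rpow_exp (by positivity) hloc htop hbot ht
    have h2 : DifferentiableAt ℂ (fun t : ℂ => (Gamma t)⁻¹) t := differentiable_one_div_Gamma t
    have h3 : DifferentiableAt ℂ (fun t : ℂ => ((2 * π : ℝ) : ℂ) ^ t) t :=
      differentiableAt_id.const_cpow (Or.inl hpi)
    exact ((h3.mul h2).mul h1).differentiableWithinAt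
  · intro t ht
    have ht0 : 0 < t.re := by linarith
    have h1 := hasSum_mellin (a := fun l : ℕ => cuspCoeff f l *
      ∑' i, w i * cexp (2 * π * I * l * x i)) (p := fun l : ℕ => 2 * π * l) (F := F) (s := t)
      ?_ ht0 (fun y hy => by simpa using hasSum_tsum_cuspLine f hw0 x hy) ?_
    · have h2 := h1.mul_left (((2 * π : ℝ) : ℂ) ^ t * (Gamma t)⁻¹)
      refine h2.congr_fun fun l => ?_
      rcases eq_or_ne l 0 with rfl | hl
      · simp [cuspCoeff_zero]
      · have h6 : ((2 * π * l : ℝ) : ℂ) ^ t = ((2 * π : ℝ) : ℂ) ^ t * (l : ℂ) ^ t := by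
          rw [ofReal_mul, mul_cpow_ofReal_nonneg (by positivity) (by positivity), ofReal_natCast]
        rw [LSeries.term_of_ne_zero hl, h6]
        have h3 : ((2 * π : ℝ) : ℂ) ^ t ≠ 0 := by simp [cpow_eq_zero_iff, Real.pi_ne_zero]
        have h4 := Gamma_ne_zero_of_re_pos ht0
        have h5 : (l : ℂ) ^ t ≠ 0 := by simp [cpow_eq_zero_iff, hl]
        field_simp
    · intro l
      rcases Nat.eq_zero_or_pos l with rfl | hl
      · left; simp [cuspCoeff_zero]
      · right; positivity
    · have h2 := (LSeriesSummable_cuspCoeff f ht).norm.mul_right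
        ((∑' i, ‖w i‖) * ((2 * π) ^ t.re)⁻¹)
      refine h2.of_nonneg_of_le (fun l => by positivity) fun l => ?_
      rcases eq_or_ne l 0 with rfl | hl
      · simp [cuspCoeff_zero]
      · rw [LSeries.norm_term_eq, if_neg hl, norm_mul, Real.mul_rpow (by positivity) (by positivity)]
        have h3 : ‖∑' i, w i * cexp (2 * π * I * l * x i)‖ ≤ ∑' i, ‖w i‖ := by
          refine tsum_of_norm_bounded hw0.hasSum fun i => ?_
          rw [norm_mul, show (2 * π * I * l * x i : ℂ) = ((2 * π * l * x i : ℝ) : ℂ) * I by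
            push_cast; ring, norm_exp_ofReal_mul_I, mul_one]
        have h4 : ‖cuspCoeff f l‖ / (l : ℝ) ^ t.re * ((∑' i, ‖w i‖) * ((2 * π) ^ t.re)⁻¹) =
          ‖cuspCoeff f l‖ * (∑' i, ‖w i‖) / ((2 * π) ^ t.re * (l : ℝ) ^ t.re) := by
          field_simp
        rw [h4]
        gcongr
  · have h1 : mellin F 1 = ∑' i, w i * ∫ y in Set.Ioi (0 : ℝ), cuspLine f (x i) y := by
      obtain ⟨D, hD, hint⟩ := exists_integral_norm_cuspLine_le f
      simp only [mellin, sub_self, cpow_zero, one_smul, hF]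
      rw [← integral_tsum_of_summable_integral_norm]
      · simp_rw [integral_const_mul]
      · exact fun i => (hint (x i) (M i) (hM i)).1.const_mul (w i)
      · refine Summable.of_nonneg_of_le (fun i => integral_nonneg fun _ => norm_nonneg _)
          (fun i => ?_) (hw.add (hw0.mul_right D))
        simp_rw [norm_mul]
        rw [integral_const_mul, ← mul_add]
        exact mul_le_mul_of_nonneg_left (hint (x i) (M i) (hM i)).2 (norm_nonneg _)
    simp only [h1, cpow_one, Gamma_one, inv_one, mul_one]
    push_cast
    ring

end Mellin

/-! ### Twisted Ramanujan sums and their Dirichlet series -/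

section CharSum

/-- The representatives `0 ≤ d < c` of the lower right entries `d mod c` of the matrices in `Γ₀(N)`
with lower left entry `c`; there are none unless `N ∣ c` and `c ≠ 0`. -/
def cuspResidues (N c : ℕ) : Finset ℕ :=
  if N ∣ c then (Finset.range c).filter (Nat.Coprime c) else ∅

theorem mem_cuspResidues {N c d : ℕ} :
    d ∈ cuspResidues N c ↔ N ∣ c ∧ d < c ∧ Nat.Coprime c d := by
  unfold cuspResidues
  split_ifs with h <;> simp [h]

theorem card_cuspResidues_le (N c : ℕ) : (cuspResidues N c).card ≤ c := by
  unfold cuspResidues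
  split_ifs
  · exact (Finset.card_filter_le _ _).trans (Finset.card_range c).le
  · simp

variable {N : ℕ} (ψ : DirichletCharacter ℂ N)

/-- The sum `∑ ψ(d) e(md/c)` over the reduced residues `d mod c`, for `N ∣ c`: a Ramanujan sum
twisted by the character `ψ`. -/
noncomputable def charSum (m : ℤ) (c : ℕ) : ℂ :=
  ∑ d ∈ cuspResidues N c, ψ d * cexp (2 * π * I * m * d / c)

/-- The sum `∑ ψ(d) e(md/c)` over all residues `d mod c`, for `N ∣ c`. -/
noncomputable def fullCharSum (m : ℤ) (c : ℕ) : ℂ :=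
  if N ∣ c then ∑ d ∈ Finset.range c, ψ d * cexp (2 * π * I * m * d / c) else 0

theorem norm_charSum_le (m : ℤ) (c : ℕ) : ‖charSum ψ m c‖ ≤ c := by
  refine (norm_sum_le_of_le (cuspResidues N c) (n := fun _ => (1 : ℝ)) fun d _ => ?_).trans ?_
  · rw [norm_mul, show (2 * π * I * m * d / c : ℂ) = ((2 * π * m * d / c : ℝ) : ℂ) * I by
      push_cast; ring, norm_exp_ofReal_mul_I, mul_one]
    exact ψ.norm_le_one _
  · simpa using card_cuspResidues_le N c

theorem LSeriesSummable_charSum (m : ℤ) {t : ℂ} (ht : 2 < t.re) :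
    LSeriesSummable (charSum ψ m) t := by
  refine LSeriesSummable_of_le_const_mul_rpow ht ⟨1, fun c _ => ?_⟩
  norm_num
  exact norm_charSum_le ψ m c

/-- Sorting the residues `d mod c` by their greatest common divisor with `c`. -/
theorem convolution_charSum (m : ℤ) :
    LSeries.convolution (fun n => ψ n) (charSum ψ m) = fullCharSum ψ m := by
  classical
  ext C
  rw [LSeries.convolution_def]
  unfold fullCharSum
  split_ifs with hNC
  swap
  · refine Finset.sum_eq_zero fun p hp => ?_
    have hp := (Nat.mem_divisorsAntidiagonal.mp hp).1
    have : ¬ N ∣ p.2 := fun h => hNC (hp ▸ h.mul_left p.1)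
    simp [charSum, cuspResidues, this]
  rcases Nat.eq_zero_or_pos C with rfl | hC
  · simp
  rw [← Finset.sum_fiberwise_of_maps_to (t := C.divisorsAntidiagonal)
    (g := fun d => (C.gcd d, C / C.gcd d))]
  swap
  · intro d _
    rw [Nat.mem_divisorsAntidiagonal]
    exact ⟨Nat.mul_div_cancel' (Nat.gcd_dvd_left C d), hC.ne'⟩
  refine Finset.sum_congr rfl fun p hp => ?_
  obtain ⟨hp, -⟩ := Nat.mem_divisorsAntidiagonal.mp hp
  have hp1 : 0 < p.1 := Nat.pos_of_ne_zero fun h => by simp [h] at hp; omega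
  have hp2 : 0 < p.2 := Nat.pos_of_ne_zero fun h => by simp [h] at hp; omega
  have hmem : ∀ d, d ∈ {d ∈ Finset.range C | (C.gcd d, C / C.gcd d) = p} ↔ d < C ∧ C.gcd d = p.1 := by
    intro d
    rw [Finset.mem_filter, Finset.mem_range, Prod.ext_iff]
    refine and_congr_right fun _ => ⟨fun h => h.1, fun h => ⟨h, ?_⟩⟩
    simp only [h]
    rw [← hp, Nat.mul_div_cancel_left _ hp1]
  by_cases hN : N ∣ p.2
  · rw [charSum, Finset.mul_sum]
    refine Finset.sum_bij (fun d _ => p.1 * d) ?_ ?_ ?_ ?_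
    · intro d hd
      obtain ⟨-, hd, hcop⟩ := mem_cuspResidues.mp hd
      rw [hmem]
      refine ⟨by rw [← hp]; exact Nat.mul_lt_mul_of_pos_left hd hp1, ?_⟩
      rw [← hp, Nat.gcd_mul_left, hcop.gcd_eq_one, mul_one]
    · intro d _ d' _ h
      exact Nat.eq_of_mul_eq_mul_left hp1 h
    · intro d hd
      obtain ⟨hd, hg⟩ := (hmem d).mp hd
      obtain ⟨e, rfl⟩ : p.1 ∣ d := hg ▸ Nat.gcd_dvd_right C d
      refine ⟨e, mem_cuspResidues.mpr ⟨hN, ?_, ?_⟩, rfl⟩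
      · rw [← hp] at hd; exact Nat.lt_of_mul_lt_mul_left hd
      · rw [← hp, Nat.gcd_mul_left] at hg
        exact Nat.eq_of_mul_eq_mul_left hp1 (by rw [hg, mul_one])
    · intro d _
      rw [← hp]
      push_cast
      have h1 : (p.1 : ℂ) ≠ 0 := by exact_mod_cast hp1.ne'
      have h2 : (p.2 : ℂ) ≠ 0 := by exact_mod_cast hp2.ne'
      have h3 : (2 * π * I * m * (p.1 * d) / (p.1 * p.2) : ℂ) = 2 * π * I * m * d / p.2 := by
        field_simp
      rw [map_mul, h3]
      ring
  · have h1 : charSum ψ m p.2 = 0 := by simp [charSum, cuspResidues, hN]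
    rw [h1, mul_zero]
    symm
    refine Finset.sum_eq_zero fun d hd => ?_
    obtain ⟨hd, hg⟩ := (hmem d).mp hd
    have h2 : ψ d = 0 := by
      refine MulChar.map_nonunit _ fun hu => hN ?_
      have hcop : Nat.Coprime d N := (ZMod.isUnit_iff_coprime d N).mp hu
      have hdvd : p.1 ∣ d := hg ▸ Nat.gcd_dvd_right C d
      exact (Nat.Coprime.coprime_dvd_left hdvd hcop).symm.dvd_of_dvd_mul_left (hp ▸ hNC)
    rw [h2, zero_mul]

theorem sum_range_exp_mul_div (m : ℤ) {r : ℕ} (hr : 0 < r) :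
    ∑ j ∈ Finset.range r, cexp (2 * π * I * m * j / r) = if (r : ℤ) ∣ m then (r : ℂ) else 0 := by
  have hr' : (r : ℂ) ≠ 0 := by exact_mod_cast hr.ne'
  set ζ := cexp (2 * π * I * m / r) with hζ
  have h1 : ∀ j : ℕ, cexp (2 * π * I * m * j / r) = ζ ^ j := fun j => by
    rw [hζ, ← Complex.exp_nat_mul]; congr 1; ring
  simp_rw [h1]
  have h2 : ζ = 1 ↔ (r : ℤ) ∣ m := by
    rw [hζ, Complex.exp_eq_one_iff]
    constructor
    · rintro ⟨n, hn⟩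
      refine ⟨n, ?_⟩
      have h3 : (2 * π * I : ℂ) ≠ 0 := two_pi_I_ne_zero
      have : (m : ℂ) = r * n := by
        have h4 : (2 * π * I) * (m : ℂ) = (2 * π * I) * (r * n) := by
          field_simp at hn
          linear_combination (2 * π * I) * hn
        exact mul_left_cancel₀ h3 h4
      exact_mod_cast this
    · rintro ⟨n, rfl⟩
      exact ⟨n, by push_cast; field_simp⟩
  split_ifs with h
  · rw [h2.mpr h]; simp
  · rw [geom_sum_eq (fun h' => h (h2.mp h'))]
    have : ζ ^ r = 1 := by
      rw [← h1, mul_div_assoc, div_self hr', mul_one, mul_comm]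
      exact Complex.exp_int_mul_two_pi_mul_I m
    rw [this, sub_self, zero_div]

theorem sum_range_mul_eq {M : Type*} [AddCommMonoid M] (g : ℕ → M) (n r : ℕ) :
    ∑ d ∈ Finset.range (n * r), g d =
      ∑ j ∈ Finset.range r, ∑ e ∈ Finset.range n, g (n * j + e) := by
  induction r with
  | zero => simp
  | succ r ih => rw [Nat.mul_succ, Finset.sum_range_add, ih, Finset.sum_range_succ]

theorem sum_range_eq_sum_zmod [NeZero N] (g : ZMod N → ℂ) :
    ∑ d ∈ Finset.range N, g d = ∑ a : ZMod N, g a := by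
  refine Finset.sum_bij (fun d _ => (d : ZMod N)) (fun _ _ => Finset.mem_univ _) ?_ ?_
    fun _ _ => rfl
  · intro a ha b hb h
    rw [ZMod.natCast_eq_natCast_iff] at h
    exact Nat.ModEq.eq_of_lt_of_lt h (Finset.mem_range.mp ha) (Finset.mem_range.mp hb)
  · intro a _
    exact ⟨a.val, Finset.mem_range.mpr (ZMod.val_lt a), ZMod.natCast_zmod_val a⟩

/-- A Gauss sum of a primitive character at an arbitrary integer `k`, also one not prime to `N`. -/
theorem sum_range_char_mul_exp [NeZero N] (hψ : ψ.IsPrimitive) (k : ℤ) :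
    ∑ d ∈ Finset.range N, ψ d * cexp (2 * π * I * k * d / N) =
      ψ⁻¹ (k : ZMod N) * gaussSum ψ ZMod.stdAddChar := by
  rw [← gaussSum_mulShift_of_isPrimitive _ hψ, gaussSum, ← sum_range_eq_sum_zmod]
  refine Finset.sum_congr rfl fun d _ => ?_
  rw [AddChar.mulShift_apply]
  have := ZMod.stdAddChar_coe (N := N) (k * d)
  push_cast at this
  rw [this]
  congr 2
  ring

/-- Writing `d = Nj + e`, the sum over `j` detects `r ∣ m` and the sum over `e` is a Gauss sum. -/
theorem fullCharSum_mul [NeZero N] (hψ : ψ.IsPrimitive) (m : ℤ) {r : ℕ} (hr : 0 < r) :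
    fullCharSum ψ m (N * r) = if (r : ℤ) ∣ m then
      r * (ψ⁻¹ ((m / r : ℤ) : ZMod N) * gaussSum ψ ZMod.stdAddChar) else 0 := by
  have hr' : (r : ℂ) ≠ 0 := by exact_mod_cast hr.ne'
  have hN' : (N : ℂ) ≠ 0 := by exact_mod_cast NeZero.ne N
  rw [fullCharSum, if_pos (Dvd.intro r rfl), sum_range_mul_eq]
  have h1 : ∀ j e : ℕ, ψ ((N * j + e : ℕ) : ZMod N) *
      cexp (2 * π * I * m * (N * j + e : ℕ) / (N * r : ℕ)) =
      cexp (2 * π * I * m * j / r) * (ψ e * cexp (2 * π * I * m * e / (N * r))) := by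
    intro j e
    have h2 : (2 * π * I * m * (N * j + e : ℕ) / (N * r : ℕ) : ℂ) =
        2 * π * I * m * j / r + 2 * π * I * m * e / (N * r) := by
      push_cast; field_simp
    rw [h2, Complex.exp_add]
    have : ((N * j + e : ℕ) : ZMod N) = e := by push_cast; simp
    rw [this]
    ring
  simp_rw [h1, ← Finset.mul_sum, ← Finset.sum_mul]
  rw [sum_range_exp_mul_div m hr]
  split_ifs with h
  · obtain ⟨k, rfl⟩ := h
    rw [Int.mul_ediv_cancel_left _ (by exact_mod_cast hr.ne'), ← sum_range_char_mul_exp ψ hψ]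
    congr 1
    refine Finset.sum_congr rfl fun e _ => ?_
    congr 2
    push_cast
    field_simp
  · simp

/-- If the Gauss sum were zero, so would be the discrete Fourier transform of `ψ`. -/
theorem gaussSum_ne_zero_of_isPrimitive [NeZero N] (hψ : ψ.IsPrimitive) :
    gaussSum ψ ZMod.stdAddChar ≠ 0 := by
  intro h
  have h1 : ZMod.dft (ψ : ZMod N → ℂ) = 0 := by
    ext k
    rw [hψ.fourierTransform_eq_inv_mul_gaussSum, h, mul_zero, Pi.zero_apply]
  have h2 : (ψ : ZMod N → ℂ) = 0 := (LinearEquiv.map_eq_zero_iff _).mp h1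
  have h3 := congr_fun h2 1
  simp at h3

theorem isPrimitive_star (hψ : ψ.IsPrimitive) : (star ψ).IsPrimitive := by
  rw [MulChar.star_eq_inv, DirichletCharacter.isPrimitive_def, DirichletCharacter.conductor_inv]
  exact hψ

theorem even_map_int {χ : DirichletCharacter ℂ N} (hχ : χ.Even) (k : ℤ) :
    χ (k : ZMod N) = χ (k.natAbs : ZMod N) := by
  rcases Int.natAbs_eq k with h | h
  · conv_lhs => rw [h]
    simp
  · conv_lhs => rw [h]
    rw [Int.cast_neg, Int.cast_natCast]
    exact DirichletCharacter.Even.eval_neg χ _ hχ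

/-- Multiplying the Dirichlet series of the twisted Ramanujan sums by `L(χ̄, t)` gives that of the
sums over all residues. Those are nonzero only for the moduli `Nr` with `r ∣ m`, which leaves a
twisted divisor sum. -/
theorem dirichletL_mul_LSeries_charSum [NeZero N] {χ : DirichletCharacter ℂ N}
    (hprim : χ.IsPrimitive) (heven : χ.Even) {m : ℤ} (hm : m ≠ 0) {t : ℂ} (ht : 2 < t.re) :
    dirichletL (star χ) t * LSeries (charSum (star χ) m) t =
      gaussSum (star χ) ZMod.stdAddChar * ((N : ℂ) ^ t)⁻¹ *
        (sigmaChi χ (t - 1) m.natAbs / (m.natAbs : ℂ) ^ (t - 1)) := by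
  classical
  rw [dirichletL, ← LSeries_convolution'
    (DirichletCharacter.LSeriesSummable_of_one_lt_re _ (by linarith))
    (LSeriesSummable_charSum (star χ) m ht), convolution_charSum, LSeries]
  have hN0 : N ≠ 0 := NeZero.ne N
  have hm0 : m.natAbs ≠ 0 := Int.natAbs_ne_zero.mpr hm
  have hinv : (star χ)⁻¹ = χ := by rw [MulChar.star_eq_inv, inv_inv]
  rw [tsum_eq_sum (s := m.natAbs.divisors.image (N * ·))]
  swap
  · intro C hC
    rcases eq_or_ne C 0 with rfl | hC0
    · simp
    rw [LSeries.term_of_ne_zero hC0]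
    by_cases hNC : N ∣ C
    · obtain ⟨r, rfl⟩ := hNC
      have hr : 0 < r := Nat.pos_of_ne_zero fun h => hC0 (by simp [h])
      rw [fullCharSum_mul _ (isPrimitive_star χ hprim) m hr, if_neg, zero_div]
      intro h
      refine hC (Finset.mem_image.mpr ⟨r, Nat.mem_divisors.mpr ⟨?_, hm0⟩, rfl⟩)
      exact Int.natCast_dvd.mp h
    · simp [fullCharSum, hNC]
  rw [Finset.sum_image fun a _ b _ h => Nat.eq_of_mul_eq_mul_left (Nat.pos_of_ne_zero hN0) h,
    ← Nat.sum_div_divisors, sigmaChi, Finset.sum_div, Finset.mul_sum]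
  refine Finset.sum_congr rfl fun d hd => ?_
  obtain ⟨⟨r, hr⟩, -⟩ := Nat.mem_divisors.mp hd
  have hd0 : 0 < d := Nat.pos_of_mem_divisors hd
  have hr0 : 0 < r := Nat.pos_of_ne_zero fun h => hm0 (by simp [hr, h])
  have hdiv : m.natAbs / d = r := by rw [hr, Nat.mul_div_cancel_left _ hd0]
  have hrm : (r : ℤ) ∣ m := Int.natCast_dvd.mpr ⟨d, by rw [hr, mul_comm]⟩
  have habs : (m / r : ℤ).natAbs = d := by
    rw [Int.natAbs_ediv_of_dvd hrm, hr, Int.natAbs_natCast, Nat.mul_div_cancel _ hr0]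
  rw [hdiv, LSeries.term_of_ne_zero (mul_ne_zero hN0 hr0.ne'),
    fullCharSum_mul _ (isPrimitive_star χ hprim) m hr0, if_pos hrm, hinv, even_map_int heven,
    habs, hr, Nat.cast_mul, Nat.cast_mul, natCast_mul_natCast_cpow, natCast_mul_natCast_cpow,
    cpow_sub _ _ (by exact_mod_cast hd0.ne'), cpow_sub _ _ (by exact_mod_cast hr0.ne')]
  have h1 : (N : ℂ) ^ t ≠ 0 := by simp [cpow_eq_zero_iff, hN0]
  have h2 : (d : ℂ) ^ t ≠ 0 := by simp [cpow_eq_zero_iff, hd0.ne']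
  have h3 : (r : ℂ) ^ t ≠ 0 := by simp [cpow_eq_zero_iff, hr0.ne']
  have h4 : (d : ℂ) ≠ 0 := by exact_mod_cast hd0.ne'
  have h5 : (r : ℂ) ≠ 0 := by exact_mod_cast hr0.ne'
  rw [cpow_one, cpow_one]
  field_simp

/-- For a nontrivial character the sum over all residues without a phase vanishes. -/
theorem LSeries_charSum_zero [NeZero N] (hN : N ≠ 1) {χ : DirichletCharacter ℂ N}
    (hprim : χ.IsPrimitive) {t : ℂ} (ht : 2 < t.re) :
    LSeries (charSum (star χ) 0) t = 0 := by
  have hL : LSeries (fun n => (star χ) n) t ≠ 0 :=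
    DirichletCharacter.LSeries_ne_zero_of_one_lt_re _ (by linarith)
  refine (mul_eq_zero.mp ?_).resolve_left hL
  rw [← LSeries_convolution'
    (DirichletCharacter.LSeriesSummable_of_one_lt_re _ (by linarith))
    (LSeriesSummable_charSum (star χ) 0 ht), convolution_charSum, LSeries]
  have h0 : ∀ C, LSeries.term (fullCharSum (star χ) 0) t C = 0 := by
    intro C
    rcases eq_or_ne C 0 with rfl | hC0
    · simp
    rw [LSeries.term_of_ne_zero hC0]
    by_cases hNC : N ∣ C
    · obtain ⟨r, rfl⟩ := hNC
      have hr : 0 < r := Nat.pos_of_ne_zero fun h => hC0 (by simp [h])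
      rw [fullCharSum_mul _ (isPrimitive_star χ hprim) 0 hr, if_pos (dvd_zero _), Int.zero_ediv,
        Int.cast_zero, MulChar.map_nonunit, zero_mul, mul_zero, zero_div]
      have : Fact (1 < N) := ⟨by have := NeZero.ne N; omega⟩
      exact not_isUnit_zero
    · simp [fullCharSum, hNC]
  simp [h0]

end CharSum

/-! ### The double cosets `Γ_∞ \ Γ₀(N) / Γ_∞` -/

section CuspIndex

/-- The pairs `(c, d mod c)` with `c > 0`, `N ∣ c` and `(c, d) = 1`. They represent the double
cosets `Γ_∞ \ Γ₀(N) / Γ_∞` other than that of the identity. -/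
abbrev CuspIndex (N : ℕ) : Type := Σ c : ℕ, cuspResidues N c

variable {N : ℕ}

theorem CuspIndex.pos (i : CuspIndex N) : 0 < i.1 :=
  lt_of_le_of_lt (Nat.zero_le _) (mem_cuspResidues.mp i.2.2).2.1

theorem summable_cuspIndex_rpow {β : ℝ} (hβ : 2 < β) :
    Summable fun i : CuspIndex N => (i.1 : ℝ) ^ (-β) := by
  rw [summable_sigma_of_nonneg fun _ => by positivity]
  refine ⟨fun c => Summable.of_finite, ?_⟩
  refine Summable.of_nonneg_of_le (fun c => tsum_nonneg fun _ => by positivity) (fun c => ?_)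
    (Real.summable_nat_rpow.mpr (show 1 - β < -1 by linarith))
  change ∑' _ : cuspResidues N c, (c : ℝ) ^ (-β) ≤ _
  rw [tsum_const, nsmul_eq_mul]
  rcases Nat.eq_zero_or_pos c with rfl | hc
  · simp [cuspResidues, Real.zero_rpow (show 1 - β ≠ 0 by linarith),
      Real.zero_rpow (show -β ≠ 0 by linarith)]
  · have hc' : (0 : ℝ) < c := by exact_mod_cast hc
    rw [sub_eq_add_neg, Real.rpow_add hc', Real.rpow_one]
    gcongr
    simpa using card_cuspResidues_le N c

/-- Summing over `d` first. The term of the Dirichlet series at `c = 0` is zero on both sides. -/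
theorem tsum_cuspIndex_charSum (ψ : DirichletCharacter ℂ N) (m : ℤ) {t : ℂ} (ht : 2 < t.re) :
    ∑' i : CuspIndex N, (i.1 : ℂ) ^ (-t) * ψ (i.2 : ℕ) * cexp (2 * π * I * m * (i.2 : ℕ) / i.1) =
      LSeries (charSum ψ m) t := by
  have hs : Summable fun i : CuspIndex N => (i.1 : ℂ) ^ (-t) * ψ (i.2 : ℕ) *
      cexp (2 * π * I * m * (i.2 : ℕ) / i.1) := by
    refine Summable.of_norm_bounded (summable_cuspIndex_rpow ht) fun i => ?_
    rw [norm_mul, norm_mul, Complex.norm_natCast_cpow_of_pos i.pos, neg_re,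
      show (2 * π * I * m * (i.2 : ℕ) / i.1 : ℂ) = ((2 * π * m * (i.2 : ℕ) / i.1 : ℝ) : ℂ) * I by
      push_cast; ring, norm_exp_ofReal_mul_I, mul_one]
    exact mul_le_of_le_one_right (by positivity) (ψ.norm_le_one _)
  rw [hs.tsum_sigma, LSeries]
  refine tsum_congr fun c => ?_
  rw [tsum_fintype, Finset.sum_coe_sort (cuspResidues N c) (fun d : ℕ => (c : ℂ) ^ (-t) * ψ d *
    cexp (2 * π * I * m * d / c))]
  rcases eq_or_ne c 0 with rfl | hc
  · simp [cuspResidues]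
  · rw [LSeries.term_of_ne_zero hc, charSum, Finset.sum_div]
    refine Finset.sum_congr rfl fun d _ => ?_
    rw [cpow_neg]
    ring

end CuspIndex

/-! ### The Bessel function `K_ν` -/

section Bessel

theorem sq_div_four_le_cosh (v : ℝ) : v ^ 2 / 4 ≤ Real.cosh v := by
  have h := Real.quadratic_le_exp_of_nonneg (abs_nonneg v)
  rw [← Real.cosh_abs, Real.cosh_eq, ← sq_abs]
  have := Real.exp_pos (-|v|)
  have := abs_nonneg v
  linarith

theorem integrable_exp_mul_exp_cosh (ν : ℂ) {x : ℝ} (hx : 0 < x) :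
    Integrable fun v : ℝ => cexp (-ν * v) * (Real.exp (-x * Real.cosh v) : ℝ) := by
  have h := (integrable_cexp_quadratic (b := ((x / 4 : ℝ) : ℂ)) (by simpa using by positivity)
    (-ν) 0).norm
  refine h.mono' (Continuous.aestronglyMeasurable (by fun_prop)) (Eventually.of_forall fun v => ?_)
  rw [norm_mul, Complex.norm_of_nonneg (Real.exp_nonneg _), Complex.norm_exp, Complex.norm_exp,
    ← Real.exp_add, Real.exp_le_exp]
  have h1 := mul_le_mul_of_nonneg_left (sq_div_four_le_cosh v) hx.le
  have h2 : (-((x / 4 : ℝ) : ℂ) * (v : ℂ) ^ 2 + -ν * v + 0).re = -(x / 4) * v ^ 2 + (-ν * v).re := by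
    rw [add_zero, add_re, ← ofReal_pow, ← ofReal_neg, ← ofReal_mul, ofReal_re]
  rw [h2]
  linarith

/-- The Mellin transform in the variable `v = -log u`. -/
theorem mellin_eq_integral_exp (g : ℝ → ℂ) (ν : ℂ) :
    mellin g ν = ∫ v : ℝ, cexp (-ν * v) * g (Real.exp (-v)) := by
  rw [mellin_eq_fourier, Real.fourier_eq']
  refine integral_congr_ae (Eventually.of_forall fun v => ?_)
  have h1 : -ν * v = ((-2 * π * (v * (ν.im / (2 * π))) : ℝ) : ℂ) * I + ((-ν.re * v : ℝ) : ℂ) := by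
    have : (π : ℂ) ≠ 0 := by exact_mod_cast Real.pi_ne_zero
    conv_lhs => rw [← re_add_im ν]
    push_cast
    field_simp
    ring
  simp only [h1, Complex.exp_add, RCLike.inner_apply, conj_trivial, smul_eq_mul, ← ofReal_exp,
    real_smul]
  rw [mul_comm (ν.im / (2 * π)) v]
  ring

/-- Folding the two-sided exponential integral at `v = 0` gives the integral that defines `K_ν`. -/
theorem mellin_exp_add_inv (ν : ℂ) {x : ℝ} (hx : 0 < x) :
    mellin (fun u : ℝ => ((Real.exp (-(x / 2) * (u + u⁻¹)) : ℝ) : ℂ)) ν = 2 * besselK ν x := by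
  rw [mellin_eq_integral_exp]
  have h0 : ∀ v : ℝ, cexp (-ν * v) * ((Real.exp (-(x / 2) *
      (Real.exp (-v) + (Real.exp (-v))⁻¹)) : ℝ) : ℂ) =
      cexp (-ν * v) * (Real.exp (-x * Real.cosh v) : ℝ) := by
    intro v
    rw [← Real.exp_neg, neg_neg, Real.cosh_eq]
    congr 3
    ring_nf
  simp_rw [h0]
  have hi := integrable_exp_mul_exp_cosh ν hx
  rw [← intervalIntegral.integral_Iic_add_Ioi hi.integrableOn hi.integrableOn (b := 0), besselK,
    ← neg_zero, ← integral_comp_neg_Ioi, neg_zero, ← integral_add, ← integral_const_mul]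
  · refine setIntegral_congr_fun measurableSet_Ioi fun v _ => ?_
    simp only [Real.cosh_neg, Complex.cosh]
    push_cast
    rw [neg_mul_neg, neg_mul ν]
    ring
  · have := (integrable_exp_mul_exp_cosh (-ν) hx).integrableOn (s := Set.Ioi 0)
    refine this.congr_fun (fun v _ => ?_) measurableSet_Ioi
    simp
  · exact hi.integrableOn

/-- The integral `∫₀^∞ u^{ν-1} e^{-αu-β/u} du` in terms of `K_ν`, with `α = x / 2ρ` and
`β = xρ / 2`. -/
theorem integral_cpow_mul_exp_eq_besselK (ν : ℂ) {x ρ : ℝ} (hx : 0 < x) (hρ : 0 < ρ) :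
    ∫ u in Set.Ioi (0 : ℝ), (u : ℂ) ^ (ν - 1) *
      ((Real.exp (-(x / (2 * ρ)) * u - x * ρ / 2 * u⁻¹) : ℝ) : ℂ) =
      2 * (ρ : ℂ) ^ ν * besselK ν x := by
  have h := mellin_comp_mul_left (fun u : ℝ => ((Real.exp (-(x / 2) * (u + u⁻¹)) : ℝ) : ℂ)) ν
    (inv_pos.mpr hρ)
  rw [mellin_exp_add_inv ν hx, mellin] at h
  have h1 : ((ρ⁻¹ : ℝ) : ℂ) ^ (-ν) = (ρ : ℂ) ^ ν := by
    rw [ofReal_inv, cpow_neg, inv_cpow _ _ (by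
      rw [arg_ofReal_of_nonneg hρ.le]; exact Real.pi_pos.ne), inv_inv]
  rw [h1, smul_eq_mul] at h
  rw [show 2 * (ρ : ℂ) ^ ν * besselK ν x = (ρ : ℂ) ^ ν * (2 * besselK ν x) by ring, ← h]
  refine setIntegral_congr_fun measurableSet_Ioi fun u hu => ?_
  have hu : 0 < u := hu
  simp only [smul_eq_mul]
  congr 3
  field_simp
  ring_nf

theorem integrableOn_rpow_mul_exp {a b : ℝ} (ha : 0 < a) (hb : 0 < b) :
    IntegrableOn (fun u : ℝ => u ^ (a - 1) * Real.exp (-b * u)) (Set.Ioi 0) := by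
  have := integrableOn_rpow_mul_exp_neg_mul_rpow (s := a - 1) (p := 1) (b := b) (by linarith)
    (by norm_num) hb
  simpa using this

/-- The Bessel function `K_ν` with `Re ν > 0` does not vanish identically, because
`2 (x/2)^ν K_ν(x)` tends to `Γ(ν)` as `x → 0`. -/
theorem exists_besselK_ne_zero {ν : ℂ} (hν : 0 < ν.re) {b : ℝ} (hb : 0 < b) :
    ∃ y : ℝ, 0 < y ∧ besselK ν (b * y) ≠ 0 := by
  by_contra! hzero
  -- `H x = 2 (x/2)^ν K_ν(x)` for `x > 0`; it has the limit `Γ(ν)` at `0`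
  set H : ℝ → ℂ := fun x => ∫ u in Set.Ioi (0 : ℝ), (u : ℂ) ^ (ν - 1) *
      ((Real.exp (-1 * u - x * (x / 2) / 2 * u⁻¹) : ℝ) : ℂ) with hH
  have hH0 : ∀ x, 0 < x → H x = 0 := by
    intro x hx
    have h := integral_cpow_mul_exp_eq_besselK ν hx (half_pos hx)
    have h2 := hzero (x / b) (by positivity)
    rw [mul_div_cancel₀ x hb.ne'] at h2
    rw [h2, mul_zero] at h
    rw [hH]
    simp only
    rw [← h]
    congr 1
    ext u
    congr 4
    field_simp
  have hlim : Tendsto H (𝓝[>] 0) (𝓝 (∫ u in Set.Ioi (0 : ℝ), (u : ℂ) ^ (ν - 1) *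
      ((Real.exp (-1 * u) : ℝ) : ℂ))) := by
    refine tendsto_integral_filter_of_dominated_convergence
      (fun u => u ^ (ν.re - 1) * Real.exp (-1 * u)) ?_ ?_
      (integrableOn_rpow_mul_exp hν one_pos) ?_
    · refine Eventually.of_forall fun x => ?_
      refine ContinuousOn.aestronglyMeasurable (fun u hu => ?_) measurableSet_Ioi
      have hu : 0 < u := hu
      refine ContinuousAt.continuousWithinAt (ContinuousAt.mul ?_ ?_)
      · exact continuousAt_ofReal_cpow_const _ _ (Or.inr hu.ne')
      · fun_prop (disch := exact hu.ne')
    · refine Eventually.of_forall fun x => ?_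
      refine (ae_restrict_iff' measurableSet_Ioi).mpr (Eventually.of_forall fun u hu => ?_)
      have hu : 0 < u := hu
      rw [norm_mul, norm_cpow_eq_rpow_re_of_pos hu, Complex.norm_of_nonneg (Real.exp_nonneg _)]
      simp only [sub_re, one_re]
      gcongr
      have : 0 ≤ x * (x / 2) / 2 * u⁻¹ := by
        have := mul_self_nonneg x
        have h3 : x * (x / 2) / 2 * u⁻¹ = x * x * (u⁻¹ / 4) := by ring
        rw [h3]; positivity
      linarith
    · refine (ae_restrict_iff' measurableSet_Ioi).mpr (Eventually.of_forall fun u hu => ?_)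
      have h1 : Continuous fun x : ℝ => (u : ℂ) ^ (ν - 1) *
        ((Real.exp (-1 * u - x * (x / 2) / 2 * u⁻¹) : ℝ) : ℂ) := by fun_prop
      have h2 := (h1.tendsto 0).mono_left (nhdsWithin_le_nhds (s := Set.Ioi 0))
      simpa using h2
  have hlim0 : Tendsto H (𝓝[>] 0) (𝓝 0) :=
    tendsto_const_nhds.congr' (by filter_upwards [self_mem_nhdsWithin] with x hx using (hH0 x hx).symm)
  have h1 := tendsto_nhds_unique hlim hlim0
  have h2 := Complex.integral_cpow_mul_exp_neg_mul_Ioi hν one_pos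
  have h3 : ∫ u in Set.Ioi (0 : ℝ), (u : ℂ) ^ (ν - 1) * ((Real.exp (-1 * u) : ℝ) : ℂ) = Gamma ν := by
    rw [ofReal_one, div_one, one_cpow, one_mul] at h2
    rw [← h2]
    congr 1
    ext u
    push_cast
    ring_nf
  exact Gamma_ne_zero_of_re_pos hν (h3.symm.trans h1)

end Bessel

/-! ### Poisson summation of `Im(-1/(z + k))^s` -/

section Poisson

open scoped FourierTransform

/-- The function `t ↦ Im(-1/(t + iy))^s = (y / (t² + y²))^s`. -/
noncomputable def imPow (s : ℂ) (y t : ℝ) : ℂ := ((y / (t ^ 2 + y ^ 2) : ℝ) : ℂ) ^ s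

theorem continuous_imPow (s : ℂ) {y : ℝ} (hy : 0 < y) : Continuous (imPow s y) := by
  have h : ∀ t : ℝ, 0 < t ^ 2 + y ^ 2 := fun t => by positivity
  refine continuous_iff_continuousAt.mpr fun t => ?_
  have h1 : ContinuousAt (fun t : ℝ => y / (t ^ 2 + y ^ 2)) t := by
    fun_prop (disch := exact (h t).ne')
  exact ContinuousAt.comp (f := fun t : ℝ => y / (t ^ 2 + y ^ 2)) (g := fun x : ℝ => (x : ℂ) ^ s)
    (continuousAt_ofReal_cpow_const _ _ (Or.inr (div_pos hy (h t)).ne')) h1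

theorem norm_imPow (s : ℂ) {y : ℝ} (hy : 0 < y) (t : ℝ) :
    ‖imPow s y t‖ = (y / (t ^ 2 + y ^ 2)) ^ s.re :=
  norm_cpow_eq_rpow_re_of_pos (by positivity) _

theorem norm_imPow_le {s : ℂ} (hs : 1 ≤ s.re) {y : ℝ} (hy : 0 < y) (t : ℝ) :
    ‖imPow s y t‖ ≤ (y⁻¹) ^ (s.re - 1) * (y * (t ^ 2 + y ^ 2)⁻¹) := by
  have h : 0 < t ^ 2 + y ^ 2 := by positivity
  have hp : 0 < y / (t ^ 2 + y ^ 2) := by positivity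
  rw [norm_imPow s hy, ← div_eq_mul_inv, show s.re = (s.re - 1) + 1 by ring, Real.rpow_add hp,
    Real.rpow_one, add_sub_cancel_right]
  gcongr
  rw [div_le_iff₀ h, ← div_eq_inv_mul, le_div_iff₀ hy]
  nlinarith [sq_nonneg t]

theorem summable_imPow {s : ℂ} (hs : 1 ≤ s.re) {y : ℝ} (hy : 0 < y) (x : ℝ) :
    Summable fun k : ℤ => imPow s y (x + k) := by
  have h := (EisensteinSeries.linear_right_summable ((x : ℂ) + y * I) 1 (k := 2) le_rfl).norm
  refine Summable.of_norm_bounded (h.mul_left ((y⁻¹) ^ (s.re - 1) * y)) fun k => ?_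
  refine (norm_imPow_le hs hy _).trans_eq ?_
  rw [mul_assoc]
  congr 2
  rw [norm_inv, norm_zpow, zpow_ofNat, ← Complex.normSq_eq_norm_sq, Complex.normSq_apply]
  simp
  ring

theorem imPow_isBigO {s : ℂ} (hs : 1 ≤ s.re) {y : ℝ} (hy : 0 < y) :
    imPow s y =O[cocompact ℝ] fun t => |t| ^ (-2 : ℝ) := by
  refine IsBigO.of_bound ((y⁻¹) ^ (s.re - 1) * y) ?_
  have h0 : ∀ᶠ t : ℝ in cocompact ℝ, t ≠ 0 := by
    have := (isCompact_singleton (x := (0 : ℝ))).compl_mem_cocompact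
    filter_upwards [this] with t ht using ht
  filter_upwards [h0] with t ht
  refine (norm_imPow_le hs hy t).trans ?_
  rw [mul_assoc, Real.norm_of_nonneg (by positivity), Real.rpow_neg (abs_nonneg t)]
  norm_num
  have : 0 < t ^ 2 := by positivity
  gcongr
  nlinarith [sq_nonneg y]

/-- The integral that represents the Fourier transform of `t ↦ (y / (t² + y²))^s`, up to a
constant. -/
noncomputable def besselIntegral (s : ℂ) (y ξ : ℝ) : ℂ :=
  ∫ u in Set.Ioi (0 : ℝ), (u : ℂ) ^ ((s - 1 / 2) - 1) *
    ((Real.exp (-y ^ 2 * u - (π * ξ) ^ 2 * u⁻¹) : ℝ) : ℂ)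

/-- The Gamma integral linearizes the power, so that the Fourier transform becomes Gaussian. -/
theorem Gamma_mul_imPow {s : ℂ} (hs : 0 < s.re) {y : ℝ} (hy : 0 < y) (t : ℝ) :
    Gamma s * imPow s y t = (y : ℂ) ^ s * ∫ u in Set.Ioi (0 : ℝ), (u : ℂ) ^ (s - 1) *
      ((Real.exp (-(t ^ 2 + y ^ 2) * u) : ℝ) : ℂ) := by
  have hr : 0 < t ^ 2 + y ^ 2 := by positivity
  have h := Complex.integral_cpow_mul_exp_neg_mul_Ioi hs hr
  have h1 : ∫ u in Set.Ioi (0 : ℝ), (u : ℂ) ^ (s - 1) *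
      ((Real.exp (-(t ^ 2 + y ^ 2) * u) : ℝ) : ℂ) =
      ∫ u in Set.Ioi (0 : ℝ), (u : ℂ) ^ (s - 1) * cexp (-(((t ^ 2 + y ^ 2 : ℝ) : ℂ) * u)) := by
    congr 1
    ext u
    push_cast
    ring_nf
  rw [h1, h, imPow, div_eq_mul_one_div, ofReal_mul, mul_cpow_ofReal_nonneg hy.le (by positivity)]
  push_cast
  ring

/-- The Fourier transform of the Gaussians `t ↦ e^{-ut²}`, integrated over `u`. -/
theorem fourier_imPow {s : ℂ} (hs : 1 / 2 < s.re) {y : ℝ} (hy : 0 < y) (ξ : ℝ) :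
    Gamma s * 𝓕 (imPow s y) ξ =
      (y : ℂ) ^ s * (π : ℂ) ^ (1 / 2 : ℂ) * besselIntegral s y ξ := by
  have hs0 : 0 < s.re := by linarith
  set k : ℝ → ℝ → ℂ := fun t u => cexp (((-2 * π * t * ξ : ℝ) : ℂ) * I) * ((u : ℂ) ^ (s - 1) *
      ((Real.exp (-(t ^ 2 + y ^ 2) * u) : ℝ) : ℂ)) with hk
  have h1 : Gamma s * 𝓕 (imPow s y) ξ = (y : ℂ) ^ s * ∫ t : ℝ, ∫ u in Set.Ioi (0 : ℝ), k t u := by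
    rw [Real.fourier_eq', ← integral_const_mul, ← integral_const_mul]
    refine integral_congr_ae (Eventually.of_forall fun t => ?_)
    simp only [smul_eq_mul, hk, RCLike.inner_apply, conj_trivial]
    rw [integral_const_mul, mul_left_comm, Gamma_mul_imPow hs0 hy, mul_left_comm]
    rw [mul_comm ξ t, ← mul_assoc (-2 * π)]
  have hnorm : ∀ t u : ℝ, 0 < u → ‖k t u‖ =
      u ^ (s.re - 1) * Real.exp (-y ^ 2 * u) * Real.exp (-u * t ^ 2) := by
    intro t u hu
    rw [hk]
    simp only [norm_mul, norm_exp_ofReal_mul_I, one_mul, norm_cpow_eq_rpow_re_of_pos hu,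
      Complex.norm_of_nonneg (Real.exp_nonneg _), sub_re, one_re]
    rw [mul_assoc, ← Real.exp_add]
    congr 2
    ring
  have hkm : AEStronglyMeasurable (Function.uncurry k)
      (volume.prod (volume.restrict (Set.Ioi (0 : ℝ)))) := by
    refine Measurable.aestronglyMeasurable ?_
    rw [hk]
    simp only [Function.uncurry_def]
    fun_prop
  have hint : Integrable (Function.uncurry k) (volume.prod (volume.restrict (Set.Ioi (0 : ℝ)))) := by
    rw [integrable_prod_iff' hkm]
    constructor
    · refine (ae_restrict_iff' measurableSet_Ioi).mpr (Eventually.of_forall fun u hu => ?_)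
      have hu : 0 < u := hu
      refine (((integrable_exp_neg_mul_sq hu).const_mul
        (u ^ (s.re - 1) * Real.exp (-y ^ 2 * u)))).mono' ?_ (Eventually.of_forall fun t => ?_)
      · rw [hk]
        exact Continuous.aestronglyMeasurable (by simp only [Function.uncurry_def]; fun_prop)
      · exact (hnorm t u hu).le
    · have h2 : IntegrableOn (fun u : ℝ => √π * (u ^ ((s.re - 1 / 2) - 1) *
          Real.exp (-y ^ 2 * u))) (Set.Ioi 0) :=
        (integrableOn_rpow_mul_exp (by linarith) (by positivity)).const_mul _
      refine h2.congr_fun (fun u hu => ?_) measurableSet_Ioi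
      have hu : 0 < u := hu
      simp only [Function.uncurry_apply_pair]
      simp_rw [hnorm _ u hu]
      rw [integral_const_mul, integral_gaussian, Real.sqrt_div Real.pi_pos.le, Real.sqrt_eq_rpow u,
        show s.re - 1 / 2 - 1 = (s.re - 1) + -(1 / 2) by ring, Real.rpow_add hu,
        Real.rpow_neg hu.le, div_eq_mul_inv]
      ring
  rw [h1, integral_integral_swap hint, mul_assoc, besselIntegral,
    ← integral_const_mul ((π : ℂ) ^ (1 / 2 : ℂ))]
  congr 1
  refine setIntegral_congr_fun measurableSet_Ioi fun u hu => ?_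
  have hu : 0 < u := hu
  have huC : (u : ℂ) ≠ 0 := by exact_mod_cast hu.ne'
  have h3 := fourierIntegral_gaussian (b := (u : ℂ)) (by simpa using hu) ((-2 * π * ξ : ℝ) : ℂ)
  have h4 : ∀ t : ℝ, k t u = (u : ℂ) ^ (s - 1) * ((Real.exp (-y ^ 2 * u) : ℝ) : ℂ) *
      (cexp (I * ((-2 * π * ξ : ℝ) : ℂ) * t) * cexp (-u * (t : ℂ) ^ 2)) := by
    intro t
    simp only [hk]
    rw [ofReal_exp, ofReal_exp, mul_left_comm, mul_assoc ((u : ℂ) ^ (s - 1))]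
    congr 1
    rw [← Complex.exp_add, ← Complex.exp_add, ← Complex.exp_add]
    congr 1
    push_cast
    ring
  simp_rw [h4]
  rw [integral_const_mul, h3]
  have h5 : ((π : ℂ) / u) ^ (1 / 2 : ℂ) = (π : ℂ) ^ (1 / 2 : ℂ) * (u : ℂ) ^ (-(1 / 2) : ℂ) := by
    rw [div_eq_mul_inv, ← ofReal_inv, mul_cpow_ofReal_nonneg Real.pi_pos.le (by positivity),
      ofReal_inv, cpow_neg, inv_cpow _ _ (by
      rw [arg_ofReal_of_nonneg hu.le]; exact Real.pi_pos.ne)]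
  have h6 : (u : ℂ) ^ (s - 1 / 2 - 1) = (u : ℂ) ^ (s - 1) * (u : ℂ) ^ (-(1 / 2) : ℂ) := by
    rw [← cpow_add _ _ huC]
    congr 1
    ring
  have h7 : ((Real.exp (-y ^ 2 * u - (π * ξ) ^ 2 * u⁻¹) : ℝ) : ℂ) =
      ((Real.exp (-y ^ 2 * u) : ℝ) : ℂ) * cexp (-((-2 * π * ξ : ℝ) : ℂ) ^ 2 / (4 * u)) := by
    rw [ofReal_exp, ofReal_exp, ← Complex.exp_add]
    congr 1
    push_cast
    field_simp
    ring
  rw [h5, h6, h7]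
  ring

/-- The factor `e^{-(πξ)²/u}` is at most `u / (πξ)²`. -/
theorem norm_besselIntegral_le {s : ℂ} (hs : 1 / 2 < s.re) {y : ℝ} (hy : 0 < y) :
    ∃ C : ℝ, ∀ ξ : ℝ, ξ ≠ 0 → ‖besselIntegral s y ξ‖ ≤ C * |ξ| ^ (-2 : ℝ) := by
  refine ⟨(π ^ 2)⁻¹ * ∫ u in Set.Ioi (0 : ℝ), u ^ ((s.re + 1 / 2) - 1) * Real.exp (-y ^ 2 * u),
    fun ξ hξ => ?_⟩
  have h := integrableOn_rpow_mul_exp (a := s.re + 1 / 2) (b := y ^ 2) (by linarith) (by positivity)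
  have hξ2 : |ξ| ^ (-2 : ℝ) = (ξ ^ 2)⁻¹ := by
    rw [Real.rpow_neg (abs_nonneg ξ)]; norm_num
  have hξp : 0 < ξ ^ 2 := by positivity
  rw [hξ2, mul_right_comm, ← mul_inv, ← mul_pow, ← integral_const_mul]
  refine norm_integral_le_of_norm_le (h.const_mul _) ?_
  refine (ae_restrict_iff' measurableSet_Ioi).mpr (Eventually.of_forall fun u hu => ?_)
  have hu : 0 < u := hu
  rw [norm_mul, norm_cpow_eq_rpow_re_of_pos hu, Complex.norm_of_nonneg (Real.exp_nonneg _),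
    sub_eq_add_neg (-y ^ 2 * u), Real.exp_add]
  have hB : 0 < (π * ξ) ^ 2 := by rw [mul_pow]; positivity
  have h2 : Real.exp (-((π * ξ) ^ 2 * u⁻¹)) ≤ ((π * ξ) ^ 2)⁻¹ * u := by
    have hv : 0 < (π * ξ) ^ 2 * u⁻¹ := by positivity
    rw [Real.exp_neg, show ((π * ξ) ^ 2)⁻¹ * u = ((π * ξ) ^ 2 * u⁻¹)⁻¹ by rw [mul_inv, inv_inv]]
    gcongr
    linarith [Real.add_one_le_exp ((π * ξ) ^ 2 * u⁻¹)]
  have h3 : u ^ ((s.re + 1 / 2) - 1) = u ^ ((s.re - 1 / 2) - 1) * u := by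
    rw [show s.re + 1 / 2 - 1 = (s.re - 1 / 2 - 1) + 1 by ring, Real.rpow_add hu, Real.rpow_one]
  rw [h3]
  have h4 : (s - 1 / 2 - 1).re = s.re - 1 / 2 - 1 := by norm_num
  rw [h4]
  calc _ ≤ u ^ (s.re - 1 / 2 - 1) * (Real.exp (-y ^ 2 * u) * (((π * ξ) ^ 2)⁻¹ * u)) := by gcongr
    _ = _ := by ring

theorem fourier_imPow_isBigO {s : ℂ} (hs : 1 / 2 < s.re) {y : ℝ} (hy : 0 < y) :
    𝓕 (imPow s y) =O[cocompact ℝ] fun t => |t| ^ (-2 : ℝ) := by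
  obtain ⟨C, hC⟩ := norm_besselIntegral_le hs hy
  have hG : Gamma s ≠ 0 := Gamma_ne_zero_of_re_pos (by linarith)
  refine IsBigO.of_bound (‖(Gamma s)⁻¹ * ((y : ℂ) ^ s * (π : ℂ) ^ (1 / 2 : ℂ))‖ * C) ?_
  have h0 : ∀ᶠ t : ℝ in cocompact ℝ, t ≠ 0 := by
    have := (isCompact_singleton (x := (0 : ℝ))).compl_mem_cocompact
    filter_upwards [this] with t ht using ht
  filter_upwards [h0] with ξ hξ
  have h1 : 𝓕 (imPow s y) ξ =
      (Gamma s)⁻¹ * ((y : ℂ) ^ s * (π : ℂ) ^ (1 / 2 : ℂ)) * besselIntegral s y ξ := by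
    rw [mul_assoc, ← fourier_imPow hs hy, ← mul_assoc, inv_mul_cancel₀ hG, one_mul]
  rw [h1, norm_mul, mul_assoc, Real.norm_of_nonneg (by positivity)]
  exact mul_le_mul_of_nonneg_left (hC ξ hξ) (norm_nonneg _)

theorem summable_fourier_imPow {s : ℂ} (hs : 1 / 2 < s.re) {y : ℝ} (hy : 0 < y) :
    Summable fun n : ℤ => 𝓕 (imPow s y) n :=
  summable_of_isBigO (Real.summable_abs_int_rpow one_lt_two)
    ((fourier_imPow_isBigO hs hy).comp_tendsto Int.tendsto_coe_cofinite)

/-- Poisson summation for `∑ Im(-1/(z + k))^s`. -/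
theorem tsum_imPow {s : ℂ} (hs : 1 ≤ s.re) {y : ℝ} (hy : 0 < y) (x : ℝ) :
    ∑' k : ℤ, imPow s y (x + k) = ∑' n : ℤ, 𝓕 (imPow s y) n * cexp (2 * π * I * n * x) := by
  rw [Real.tsum_eq_tsum_fourier_of_rpow_decay (continuous_imPow s hy) one_lt_two
    (imPow_isBigO hs hy) (fourier_imPow_isBigO (by linarith) hy) x]
  refine tsum_congr fun n => ?_
  rw [fourier_coe_apply]
  norm_num

/-- The series `∑ |Im(-1/(z + k))^s|` is bounded uniformly in `Re z`. -/
theorem exists_tsum_norm_imPow_le {s : ℂ} (hs : 1 ≤ s.re) {y : ℝ} (hy : 0 < y) :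
    ∃ B : ℝ, ∀ x : ℝ, ∑' k : ℤ, ‖imPow s y (x + k)‖ ≤ B := by
  have hs' : 1 ≤ ((s.re : ℝ) : ℂ).re := by simpa using hs
  -- the absolute values are the same series at the real point `Re s`, to which Poisson summation
  -- applies again
  refine ⟨∑' n : ℤ, ‖𝓕 (imPow (s.re : ℂ) y) n‖, fun x => ?_⟩
  have h1 : ∀ t, imPow (s.re : ℂ) y t = ((‖imPow s y t‖ : ℝ) : ℂ) := fun t => by
    rw [norm_imPow s hy, imPow, ofReal_cpow (by positivity)]
  have h2 : ((∑' k : ℤ, ‖imPow s y (x + k)‖ : ℝ) : ℂ) = ∑' k : ℤ, imPow (s.re : ℂ) y (x + k) := by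
    rw [ofReal_tsum]
    exact tsum_congr fun k => (h1 _).symm
  have h3 : ∑' k : ℤ, ‖imPow s y (x + k)‖ = ‖∑' k : ℤ, imPow (s.re : ℂ) y (x + k)‖ := by
    rw [← h2, Complex.norm_of_nonneg (tsum_nonneg fun _ => norm_nonneg _)]
  rw [h3, tsum_imPow hs' hy]
  refine tsum_of_norm_bounded (summable_fourier_imPow (by linarith) hy).norm.hasSum fun n => ?_
  rw [norm_mul, show (2 * π * I * n * x : ℂ) = ((2 * π * n * x : ℝ) : ℂ) * I by push_cast; ring,
    norm_exp_ofReal_mul_I, mul_one]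

/-- The frequency `0` gives the factor `y^{1-s}` of the constant term. -/
theorem fourier_imPow_zero {s : ℂ} (hs : 1 / 2 < s.re) {y : ℝ} (hy : 0 < y) :
    𝓕 (imPow s y) 0 =
      (π : ℂ) ^ (1 / 2 : ℂ) * Gamma (s - 1 / 2) / Gamma s * (y : ℂ) ^ (1 - s) := by
  have hG : Gamma s ≠ 0 := Gamma_ne_zero_of_re_pos (by linarith)
  have hyC : (y : ℂ) ≠ 0 := by exact_mod_cast hy.ne'
  have h := fourier_imPow hs hy 0
  have h1 : besselIntegral s y 0 = (y : ℂ) ^ (1 - 2 * s) * Gamma (s - 1 / 2) := by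
    have h2 := Complex.integral_cpow_mul_exp_neg_mul_Ioi (a := s - 1 / 2) (r := y ^ 2)
      (by norm_num; linarith) (by positivity)
    have h3 : (1 / ((y ^ 2 : ℝ) : ℂ)) ^ (s - 1 / 2) = (y : ℂ) ^ (1 - 2 * s) := by
      rw [one_div, inv_cpow _ _ (by
        rw [arg_ofReal_of_nonneg (by positivity)]; exact Real.pi_pos.ne), ← cpow_neg, ofReal_pow,
        sq, mul_cpow_ofReal_nonneg hy.le hy.le, ← cpow_add _ _ hyC]
      congr 1
      ring
    rw [← h3, ← h2, besselIntegral]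
    congr 1
    ext u
    push_cast
    ring_nf
  rw [h1] at h
  have h4 : (y : ℂ) ^ (1 - s) = (y : ℂ) ^ s * (y : ℂ) ^ (1 - 2 * s) := by
    rw [← cpow_add _ _ hyC]
    congr 1
    ring
  rw [h4, div_mul_eq_mul_div, eq_div_iff hG, mul_comm, h]
  ring

/-- The frequency `n ≠ 0` gives the Whittaker function `W_s(nz)`. -/
theorem fourier_imPow_of_ne_zero {s : ℂ} (hs : 1 / 2 < s.re) {n : ℤ} (hn : n ≠ 0) (z : ℍ) :
    𝓕 (imPow s z.im) n * cexp (2 * π * I * n * z.re) =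
      (π : ℂ) ^ s * ((|(n : ℝ)| : ℝ) : ℂ) ^ (s - 1) / Gamma s * whittakerW s n z := by
  have hG : Gamma s ≠ 0 := Gamma_ne_zero_of_re_pos (by linarith)
  have hy : 0 < z.im := z.im_pos
  set y := z.im
  have hyC : (y : ℂ) ≠ 0 := by exact_mod_cast hy.ne'
  have hn' : 0 < |(n : ℝ)| := abs_pos.mpr (by exact_mod_cast hn)
  set m := |(n : ℝ)| with hm
  have hmC : (m : ℂ) ≠ 0 := by exact_mod_cast hn'.ne'
  have hπC : (π : ℂ) ≠ 0 := by exact_mod_cast Real.pi_ne_zero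
  have h := fourier_imPow hs hy n
  have h1 : besselIntegral s y n =
      2 * ((π * m / y : ℝ) : ℂ) ^ (s - 1 / 2) * besselK (s - 1 / 2) (2 * π * m * y) := by
    rw [← integral_cpow_mul_exp_eq_besselK _ (by positivity) (by positivity), besselIntegral]
    congr 1
    ext u
    congr 3
    rw [mul_pow π, ← sq_abs (n : ℝ), ← hm]
    field_simp
  have h2 : ((π * m / y : ℝ) : ℂ) ^ (s - 1 / 2) =
      (π : ℂ) ^ (s - 1 / 2) * (m : ℂ) ^ (s - 1 / 2) * (y : ℂ) ^ (1 / 2 - s) := by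
    rw [div_eq_mul_inv, ofReal_mul, mul_cpow_ofReal_nonneg (by positivity) (by positivity),
      ofReal_mul, mul_cpow_ofReal_nonneg (by positivity) (by positivity), ofReal_inv,
      inv_cpow _ _ (by rw [arg_ofReal_of_nonneg hy.le]; exact Real.pi_pos.ne), ← cpow_neg,
      neg_sub]
  have h3 : (π : ℂ) ^ s = (π : ℂ) ^ (1 / 2 : ℂ) * (π : ℂ) ^ (s - 1 / 2) := by
    rw [← cpow_add _ _ hπC]; congr 1; ring
  have h4 : (m : ℂ) ^ (s - 1 / 2) = (m : ℂ) ^ (s - 1) * (m : ℂ) ^ (1 / 2 : ℂ) := by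
    rw [← cpow_add _ _ hmC]; congr 1; ring
  have h5 : (y : ℂ) ^ (1 / 2 : ℂ) = (y : ℂ) ^ s * (y : ℂ) ^ (1 / 2 - s) := by
    rw [← cpow_add _ _ hyC]; congr 1; ring
  have h6 : ((√(m * y) : ℝ) : ℂ) = (m : ℂ) ^ (1 / 2 : ℂ) * (y : ℂ) ^ (1 / 2 : ℂ) := by
    rw [Real.sqrt_eq_rpow, ofReal_cpow (by positivity), ofReal_mul,
      mul_cpow_ofReal_nonneg hn'.le hy.le]
    norm_num
  rw [whittakerW, h6, h5, h3, div_mul_eq_mul_div, eq_div_iff hG, mul_right_comm, mul_comm _ (Gamma s),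
    h, h1, h2, h4]
  ring

end Poisson

/-! ### The cosets `Γ_∞ \ Γ₀(N)` -/

section Cosets

variable {N : ℕ}

theorem exists_gamma0_row (p : CuspIndex N × ℤ) : ∃ γ : CongruenceSubgroup.Gamma0 N,
    (γ : SL(2, ℤ)) 1 0 = p.1.1 ∧ (γ : SL(2, ℤ)) 1 1 = (p.1.2 : ℕ) + p.1.1 * p.2 := by
  obtain ⟨hN, -, hcop⟩ := mem_cuspResidues.mp p.1.2.2
  have h : IsCoprime (p.1.1 : ℤ) ((p.1.2 : ℕ) + p.1.1 * p.2) :=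
    (Nat.isCoprime_iff_coprime.mpr hcop).add_mul_left_right _
  obtain ⟨g, h0, h1⟩ := h.exists_SL2_row 1
  refine ⟨⟨g, ?_⟩, h0, h1⟩
  rw [CongruenceSubgroup.Gamma0_mem, h0, Int.cast_natCast]
  exact (ZMod.natCast_eq_zero_iff _ _).mpr hN

/-- A matrix in `Γ₀(N)` with lower row `(c, d + ck)`. -/
noncomputable def cuspMatrix (p : CuspIndex N × ℤ) : CongruenceSubgroup.Gamma0 N :=
  (exists_gamma0_row p).choose

theorem cuspMatrix_one_zero (p : CuspIndex N × ℤ) :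
    (cuspMatrix p : SL(2, ℤ)) 1 0 = p.1.1 := (exists_gamma0_row p).choose_spec.1

theorem cuspMatrix_one_one (p : CuspIndex N × ℤ) :
    (cuspMatrix p : SL(2, ℤ)) 1 1 = (p.1.2 : ℕ) + p.1.1 * p.2 :=
  (exists_gamma0_row p).choose_spec.2

/-- Left multiplication by `Γ_∞` changes the lower row at most by a sign. -/
theorem rightRel_GammaInf_iff (γ δ : CongruenceSubgroup.Gamma0 N) :
    QuotientGroup.rightRel (GammaInf N) γ δ ↔
      ((δ : SL(2, ℤ)) 1 0 = (γ : SL(2, ℤ)) 1 0 ∧ (δ : SL(2, ℤ)) 1 1 = (γ : SL(2, ℤ)) 1 1) ∨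
      ((δ : SL(2, ℤ)) 1 0 = -(γ : SL(2, ℤ)) 1 0 ∧ (δ : SL(2, ℤ)) 1 1 = -(γ : SL(2, ℤ)) 1 1) := by
  have hmem : QuotientGroup.rightRel (GammaInf N) γ δ ↔
      (δ : SL(2, ℤ)) 1 0 * (γ : SL(2, ℤ)) 1 1 - (δ : SL(2, ℤ)) 1 1 * (γ : SL(2, ℤ)) 1 0 = 0 := by
    rw [QuotientGroup.rightRel_apply]
    change ((δ * γ⁻¹ : CongruenceSubgroup.Gamma0 N) : SL(2, ℤ)) 1 0 = 0 ↔ _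
    rw [Subgroup.coe_mul, Subgroup.coe_inv, Matrix.SpecialLinearGroup.coe_mul,
      Matrix.SpecialLinearGroup.coe_inv, Matrix.adjugate_fin_two, Matrix.mul_apply,
      Fin.sum_univ_two]
    simp [sub_eq_add_neg]
  have hγ := (γ : SL(2, ℤ)).det_coe
  have hδ := (δ : SL(2, ℤ)).det_coe
  rw [Matrix.det_fin_two] at hγ hδ
  rw [hmem]
  set a := (γ : SL(2, ℤ)) 0 0
  set b := (γ : SL(2, ℤ)) 0 1
  set c := (γ : SL(2, ℤ)) 1 0
  set d := (γ : SL(2, ℤ)) 1 1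
  set a' := (δ : SL(2, ℤ)) 0 0
  set b' := (δ : SL(2, ℤ)) 0 1
  set c' := (δ : SL(2, ℤ)) 1 0
  set d' := (δ : SL(2, ℤ)) 1 1
  constructor
  · intro h
    -- the lower row of `δ` is the multiple of that of `γ` by the unit `a d' - b c'`
    have h1 : c' = (a * d' - b * c') * c := by linear_combination (-c') * hγ + a * h
    have h2 : d' = (a * d' - b * c') * d := by linear_combination (-d') * hγ + b * h
    have h3 : (a * d' - b * c') * (a' * d - b' * c) = 1 := by
      linear_combination hδ - a' * h2 + b' * h1
    rcases Int.eq_one_or_neg_one_of_mul_eq_one h3 with h4 | h4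
    · left; rw [h4, one_mul] at h1 h2; exact ⟨h1, h2⟩
    · right; rw [h4, neg_one_mul] at h1 h2; exact ⟨h1, h2⟩
  · rintro (⟨h1, h2⟩ | ⟨h1, h2⟩) <;> rw [h1, h2] <;> ring

/-- The coset `Γ_∞ γ` of the matrices with lower row `±(c, d + ck)`. -/
noncomputable def cuspCoset (p : CuspIndex N × ℤ) :
    Quotient (QuotientGroup.rightRel (GammaInf N)) :=
  Quotient.mk _ (cuspMatrix p)

theorem cuspCoset_injective : Function.Injective (cuspCoset (N := N)) := by
  intro p p' h
  have hr := Quotient.exact h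
  change QuotientGroup.rightRel (GammaInf N) _ _ at hr
  rw [rightRel_GammaInf_iff, cuspMatrix_one_zero, cuspMatrix_one_zero, cuspMatrix_one_one,
    cuspMatrix_one_one] at hr
  have hpos := p.1.pos
  have hpos' := p'.1.pos
  obtain ⟨⟨c, d, hd⟩, k⟩ := p
  obtain ⟨⟨c', d', hd'⟩, k'⟩ := p'
  obtain ⟨-, hlt, -⟩ := mem_cuspResidues.mp hd
  obtain ⟨-, hlt', -⟩ := mem_cuspResidues.mp hd'
  simp only at hr hpos hpos'
  rcases hr with ⟨h1, h2⟩ | ⟨h1, -⟩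
  · obtain rfl : c' = c := by exact_mod_cast h1
    have h3 : (d' : ℤ) = d := by
      have h4 := congrArg (· % (c' : ℤ)) h2
      simp only [Int.add_mul_emod_self_left] at h4
      rwa [Int.emod_eq_of_lt (by positivity) (by exact_mod_cast hlt'),
        Int.emod_eq_of_lt (by positivity) (by exact_mod_cast hlt)] at h4
    obtain rfl : d' = d := by exact_mod_cast h3
    have h5 : k' = k := by
      have : (c' : ℤ) * k' = c' * k := by linarith
      exact mul_left_cancel₀ (by exact_mod_cast hpos.ne') this
    rw [h5]
  · omega

/-- Every coset other than `Γ_∞` itself has the form `cuspCoset p`. -/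
theorem mem_range_cuspCoset (γ : CongruenceSubgroup.Gamma0 N) (hc : (γ : SL(2, ℤ)) 1 0 ≠ 0) :
    (Quotient.mk _ γ : Quotient (QuotientGroup.rightRel (GammaInf N))) ∈
      Set.range (cuspCoset (N := N)) := by
  have hγ := (γ : SL(2, ℤ)).det_coe
  rw [Matrix.det_fin_two] at hγ
  have hdvd : (N : ℤ) ∣ (γ : SL(2, ℤ)) 1 0 :=
    (ZMod.intCast_zmod_eq_zero_iff_dvd _ _).mp (CongruenceSubgroup.Gamma0_mem.mp γ.2)
  -- up to the sign of the lower row, `c > 0`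
  have key : ∀ c d : ℤ, 0 < c → (N : ℤ) ∣ c → IsCoprime c d →
      ∃ p : CuspIndex N × ℤ, (p.1.1 : ℤ) = c ∧ ((p.1.2 : ℕ) : ℤ) + p.1.1 * p.2 = d := by
    intro c d hc hN hcop
    lift c to ℕ using hc.le
    have hd0 : 0 ≤ d % c := Int.emod_nonneg _ hc.ne'
    have hmem : (d % c).toNat ∈ cuspResidues N c := by
      refine mem_cuspResidues.mpr ⟨by exact_mod_cast hN, ?_, ?_⟩
      · have := Int.emod_lt_of_pos d hc
        omega
      · rw [← Nat.isCoprime_iff_coprime, Int.toNat_of_nonneg hd0, Int.emod_def, sub_eq_add_neg,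
          ← mul_neg]
        exact hcop.add_mul_left_right _
    refine ⟨⟨⟨c, ⟨(d % c).toNat, hmem⟩⟩, d / c⟩, rfl, ?_⟩
    simp only [Int.toNat_of_nonneg hd0]
    exact Int.emod_add_mul_ediv d c
  have hcop : IsCoprime ((γ : SL(2, ℤ)) 1 0) ((γ : SL(2, ℤ)) 1 1) :=
    ⟨-(γ : SL(2, ℤ)) 0 1, (γ : SL(2, ℤ)) 0 0, by linear_combination hγ⟩
  rcases lt_or_gt_of_ne hc with h | h
  · obtain ⟨p, h1, h2⟩ := key _ _ (neg_pos.mpr h) ((dvd_neg).mpr hdvd) (hcop.neg_left.neg_right)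
    refine ⟨p, Quotient.sound ?_⟩
    change QuotientGroup.rightRel (GammaInf N) _ _
    rw [rightRel_GammaInf_iff, cuspMatrix_one_zero, cuspMatrix_one_one]
    exact Or.inr ⟨by linarith, by linarith⟩
  · obtain ⟨p, h1, h2⟩ := key _ _ h hdvd hcop
    refine ⟨p, Quotient.sound ?_⟩
    change QuotientGroup.rightRel (GammaInf N) _ _
    rw [rightRel_GammaInf_iff, cuspMatrix_one_zero, cuspMatrix_one_one]
    exact Or.inl ⟨h1.symm, h2.symm⟩

theorem eisensteinCosetTerm_eq_zero (f : CuspForm2 N) {χ : DirichletCharacter ℂ N} (hχ : χ.Even)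
    (s : ℂ) (z : ℍ) (q : Quotient (QuotientGroup.rightRel (GammaInf N)))
    (hq : q ∉ Set.range (cuspCoset (N := N))) : eisensteinCosetTerm f hχ s z q = 0 := by
  induction q using Quotient.inductionOn with
  | h γ =>
    have hc : (γ : SL(2, ℤ)) 1 0 = 0 := by
      by_contra hc
      exact hq (mem_range_cuspCoset γ hc)
    change eisensteinTerm f χ s z γ = 0
    rw [eisensteinTerm, modularSymbol, if_pos hc]
    simp

/-- The weight `conj(χ(d)) c^{-2s}` of a cusp. -/
noncomputable def cuspWeight (χ : DirichletCharacter ℂ N) (s : ℂ) (i : CuspIndex N) : ℂ :=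
  (i.1 : ℂ) ^ (-(2 * s)) * (star χ) (i.2 : ℕ)

/-- The integral of `f` along the vertical line above the cusp `-d/c`. -/
noncomputable def cuspIntegral (f : CuspForm2 N) (i : CuspIndex N) : ℂ :=
  ∫ y in Set.Ioi (0 : ℝ), cuspLine f (-((i.2 : ℕ) / i.1)) y

theorem cuspLine_sub_int (f : CuspForm2 N) (x y : ℝ) (k : ℤ) :
    cuspLine f (x - k) y = cuspLine f x y := by
  have h := (cuspForm_periodic f).sub_int_mul_eq (x := (x + y * I : ℂ)) k
  simp only [mul_one] at h
  rw [cuspLine, cuspLine, ← h]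
  congr 2
  push_cast
  ring

/-- The term of the Eisenstein series on the coset of `(c, d + ck)`. The modular symbol depends only
on `d mod c`, because it is an integral of the periodic function `f` above `-d/c - k`. -/
theorem eisensteinCosetTerm_cuspCoset (f : CuspForm2 N) {χ : DirichletCharacter ℂ N}
    (hχ : χ.Even) (s : ℂ) (z : ℍ) (p : CuspIndex N × ℤ) :
    eisensteinCosetTerm f hχ s z (cuspCoset p) =
      I * (cuspWeight χ s p.1 * cuspIntegral f p.1) *
        imPow s z.im (z.re + (p.1.2 : ℕ) / p.1.1 + p.2) := by
  have hc : (0 : ℝ) < p.1.1 := by exact_mod_cast p.1.pos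
  have hcC : (p.1.1 : ℂ) ≠ 0 := by exact_mod_cast hc.ne'
  have hy := z.im_pos
  change eisensteinTerm f χ s z (cuspMatrix p) = _
  have hN : ((p.1.1 : ℕ) : ZMod N) = 0 :=
    (ZMod.natCast_eq_zero_iff _ _).mpr (mem_cuspResidues.mp p.1.2.2).1
  have h1 : CongruenceSubgroup.Gamma0Map N (cuspMatrix p) = ((p.1.2 : ℕ) : ZMod N) := by
    change (((cuspMatrix p : SL(2, ℤ)) 1 1 : ℤ) : ZMod N) = _
    rw [cuspMatrix_one_one]
    push_cast
    rw [hN]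
    ring
  have h2 : modularSymbol f (cuspMatrix p : SL(2, ℤ)) = I * cuspIntegral f p.1 := by
    rw [modularSymbol_eq_integral f _ (by rw [cuspMatrix_one_zero]; exact_mod_cast p.1.pos),
      cuspMatrix_one_zero, cuspMatrix_one_one, cuspIntegral]
    congr 2
    ext y
    rw [← cuspLine_sub_int f (-((p.1.2 : ℕ) / p.1.1 : ℝ)) y p.2]
    congr 1
    push_cast
    field_simp
    ring
  have h3 : ((cuspMatrix p : SL(2, ℤ)) • z).im = ((p.1.1 : ℝ) ^ 2)⁻¹ *
      (z.im / ((z.re + (p.1.2 : ℕ) / p.1.1 + p.2) ^ 2 + z.im ^ 2)) := by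
    rw [ModularGroup.im_smul_eq_div_normSq, ModularGroup.denom_apply, cuspMatrix_one_zero,
      cuspMatrix_one_one, Complex.normSq_apply]
    have h4 : (0 : ℝ) < (z.re + (p.1.2 : ℕ) / p.1.1 + p.2) ^ 2 + z.im ^ 2 := by positivity
    have h5 : (((p.1.1 : ℤ) : ℂ) * z + (((p.1.2 : ℕ) + p.1.1 * p.2 : ℤ) : ℂ)) =
        ((p.1.1 * (z.re + (p.1.2 : ℕ) / p.1.1 + p.2) : ℝ) : ℂ) + ((p.1.1 * z.im : ℝ) : ℂ) * I := by
      conv_lhs => rw [show (z : ℂ) = z.re + z.im * I from (re_add_im (z : ℂ)).symm]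
      push_cast
      field_simp
      ring
    rw [h5]
    simp only [add_re, add_im, ofReal_re, ofReal_im, mul_re, mul_im, Complex.I_re, Complex.I_im, mul_zero, mul_one,
      sub_zero, add_zero, zero_add]
    field_simp
  have h6 : ((((p.1.1 : ℝ) ^ 2)⁻¹ : ℝ) : ℂ) ^ s = (p.1.1 : ℂ) ^ (-(2 * s)) := by
    rw [ofReal_inv, inv_cpow _ _ (by
      rw [arg_ofReal_of_nonneg (by positivity)]; exact Real.pi_pos.ne), ← cpow_neg, ofReal_pow,
      sq, mul_cpow_ofReal_nonneg hc.le hc.le, ofReal_natCast, ← cpow_add _ _ hcC]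
    congr 1
    ring
  rw [eisensteinTerm, h1, h2, h3, ofReal_mul, mul_cpow_ofReal_nonneg (by positivity) (by positivity),
    h6, cuspWeight, MulChar.star_apply, imPow]
  simp only [RCLike.star_def]
  ring

section Bounds

variable [NeZero N]

theorem exists_cuspIndex_bound (f : CuspForm2 N) : ∃ C : ℝ, 0 < C ∧ ∀ (i : CuspIndex N) (y : ℝ),
    0 < y → ‖cuspLine f (-((i.2 : ℕ) / i.1)) y‖ ≤ C * (i.1 : ℝ) ^ 2 := by
  obtain ⟨C, hC, h⟩ := exists_cuspLine_bound_cusp f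
  refine ⟨C, hC, fun i y hy => ?_⟩
  have := h (cuspMatrix (i, 0)) (by rw [cuspMatrix_one_zero]; exact_mod_cast i.pos) y hy
  rw [cuspMatrix_one_zero, cuspMatrix_one_one] at this
  simpa using this

omit [NeZero N] in
theorem norm_cuspWeight_le (χ : DirichletCharacter ℂ N) (s : ℂ) (i : CuspIndex N) :
    ‖cuspWeight χ s i‖ ≤ (i.1 : ℝ) ^ (-(2 * s.re)) := by
  rw [cuspWeight, norm_mul, Complex.norm_natCast_cpow_of_pos i.pos]
  have : (-(2 * s)).re = -(2 * s.re) := by simp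
  rw [this]
  exact mul_le_of_le_one_right (by positivity) (DirichletCharacter.norm_le_one _ _)

omit [NeZero N] in
theorem one_le_cuspIndex_sq (i : CuspIndex N) : (1 : ℝ) ≤ (i.1 : ℝ) ^ 2 := by
  have : (1 : ℝ) ≤ i.1 := by exact_mod_cast i.pos
  nlinarith

omit [NeZero N] in
theorem summable_norm_cuspWeight_mul_sq (χ : DirichletCharacter ℂ N) {s : ℂ} (hs : 2 < s.re) :
    Summable fun i : CuspIndex N => ‖cuspWeight χ s i‖ * (i.1 : ℝ) ^ 2 := by
  refine Summable.of_nonneg_of_le (fun i => by positivity) (fun i => ?_)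
    (summable_cuspIndex_rpow (N := N) (β := 2 * s.re - 2) (by linarith))
  have hc : (0 : ℝ) < i.1 := by exact_mod_cast i.pos
  refine (mul_le_mul_of_nonneg_right (norm_cuspWeight_le χ s i) (by positivity)).trans_eq ?_
  rw [show -(2 * s.re - 2) = -(2 * s.re) + (2 : ℕ) by push_cast; ring, Real.rpow_add hc,
    Real.rpow_natCast]

theorem summable_norm_cuspWeight_mul_integral (f : CuspForm2 N) (χ : DirichletCharacter ℂ N) {s : ℂ}
    (hs : 2 < s.re) : Summable fun i : CuspIndex N => ‖cuspWeight χ s i * cuspIntegral f i‖ := by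
  obtain ⟨C, hC, h⟩ := exists_cuspIndex_bound f
  obtain ⟨D, hD, hint⟩ := exists_integral_norm_cuspLine_le f
  refine Summable.of_nonneg_of_le (fun i => norm_nonneg _) (fun i => ?_)
    ((summable_norm_cuspWeight_mul_sq χ hs).mul_right (C + D))
  rw [norm_mul, mul_assoc]
  refine mul_le_mul_of_nonneg_left ?_ (norm_nonneg _)
  refine (norm_integral_le_integral_norm _).trans ((hint _ _ (h i)).2.trans ?_)
  have := one_le_cuspIndex_sq i
  nlinarith

end Bounds

end Cosets

/-! ### The Fourier expansion of the Eisenstein series -/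

section FourierExpansion

open scoped FourierTransform

variable {N : ℕ} [NeZero N]

/-- The series `∑ conj(χ(d)) c^{-2s} (∫₀^∞ f(-d/c + iy) dy) e(nd/c)`, over all `(c, d mod c)`. Up to
elementary factors it is the `n`-th Fourier coefficient of the Eisenstein series. -/
noncomputable def symbolSeries (f : CuspForm2 N) (χ : DirichletCharacter ℂ N) (s : ℂ) (n : ℤ) : ℂ :=
  ∑' i : CuspIndex N, cuspWeight χ s i * cuspIntegral f i *
    cexp (2 * π * I * n * ((i.2 : ℕ) / i.1 : ℝ))

/-- The Fourier coefficients of `E*(z, s; χ)`. -/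
noncomputable def eisensteinCoeff (f : CuspForm2 N) (χ : DirichletCharacter ℂ N) (s : ℂ) (n : ℤ) :
    ℂ :=
  if n = 0 then
    (π : ℂ) ^ (1 / 2 : ℂ) * Gamma (s - 1 / 2) / Gamma s * (I * symbolSeries f χ s 0)
  else (π : ℂ) ^ s * ((|(n : ℝ)| : ℝ) : ℂ) ^ (s - 1) / Gamma s * (I * symbolSeries f χ s n)

theorem norm_exp_two_pi_mul (n : ℤ) (x : ℝ) : ‖cexp (2 * π * I * n * x)‖ = 1 := by
  rw [show (2 * π * I * n * x : ℂ) = ((2 * π * n * x : ℝ) : ℂ) * I by push_cast; ring,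
    norm_exp_ofReal_mul_I]

variable (f : CuspForm2 N) {χ : DirichletCharacter ℂ N} (hχ : χ.Even) {s : ℂ} (hs : 2 < s.re)
include hs

/-- Absolute convergence, with the sum over the translations `k` bounded uniformly. -/
theorem summable_cuspIndex_imPow (χ : DirichletCharacter ℂ N) (z : ℍ) :
    Summable fun p : CuspIndex N × ℤ => I * (cuspWeight χ s p.1 * cuspIntegral f p.1) *
        imPow s z.im (z.re + (p.1.2 : ℕ) / p.1.1 + p.2) := by
  have hs1 : 1 ≤ s.re := by linarith
  obtain ⟨B, hB⟩ := exists_tsum_norm_imPow_le hs1 z.im_pos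
  refine Summable.of_norm ?_
  rw [summable_prod_of_nonneg fun p => norm_nonneg _]
  simp only [norm_mul, norm_I, one_mul]
  refine ⟨fun i => ((summable_imPow hs1 z.im_pos _).norm).mul_left _, ?_⟩
  refine Summable.of_nonneg_of_le (fun i => tsum_nonneg fun _ => by positivity) (fun i => ?_)
    ((summable_norm_cuspWeight_mul_integral f χ hs).mul_right B)
  rw [tsum_mul_left, norm_mul]
  exact mul_le_mul_of_nonneg_left (hB _) (by positivity)

theorem summable_eisensteinCosetTerm (z : ℍ) : Summable (eisensteinCosetTerm f hχ s z) := by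
  rw [← cuspCoset_injective.summable_iff (eisensteinCosetTerm_eq_zero f hχ s z)]
  refine (summable_cuspIndex_imPow f hs χ z).congr fun p => ?_
  rw [Function.comp_apply, eisensteinCosetTerm_cuspCoset]

/-- The sum over the translations `k` is expanded by Poisson summation. -/
theorem eisensteinStar_eq_tsum (z : ℍ) :
    eisensteinStar f hχ s z = ∑' i : CuspIndex N, ∑' n : ℤ,
      I * (cuspWeight χ s i * cuspIntegral f i) *
        (𝓕 (imPow s z.im) n * cexp (2 * π * I * n * (z.re + (i.2 : ℕ) / i.1 : ℝ))) := by
  rw [eisensteinStar, ← cuspCoset_injective.tsum_eq]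
  swap
  · intro q hq
    by_contra h
    exact hq (eisensteinCosetTerm_eq_zero f hχ s z q h)
  simp_rw [eisensteinCosetTerm_cuspCoset]
  rw [(summable_cuspIndex_imPow f hs χ z).tsum_prod]
  refine tsum_congr fun i => ?_
  simp only
  rw [tsum_mul_left, tsum_mul_left, tsum_imPow (by linarith) z.im_pos]

theorem hasFourierExpansion_eisensteinCoeff :
    HasFourierExpansion (eisensteinStar f hχ s) s (eisensteinCoeff f χ s) := by
  intro z
  set u : CuspIndex N × ℤ → ℂ := fun p => I * (cuspWeight χ s p.1 * cuspIntegral f p.1) *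
    (𝓕 (imPow s z.im) p.2 * cexp (2 * π * I * p.2 * (z.re + (p.1.2 : ℕ) / p.1.1 : ℝ))) with hu
  have hsum : Summable fun n : ℤ => 𝓕 (imPow s z.im) n :=
    summable_fourier_imPow (by linarith) z.im_pos
  have hus : Summable u := by
    refine Summable.of_norm ?_
    refine ((summable_norm_cuspWeight_mul_integral f χ hs).mul_of_nonneg hsum.norm
      (fun _ => norm_nonneg _) (fun _ => norm_nonneg _)).congr fun p => ?_
    rw [hu]
    simp only [norm_mul, norm_I, one_mul, norm_exp_two_pi_mul, mul_one]
  rw [eisensteinStar_eq_tsum f hχ hs, ← hus.tsum_prod]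
  refine ((Equiv.prodComm ℤ (CuspIndex N)).hasSum_iff.mpr hus.hasSum).prod_fiberwise fun n => ?_
  have hw : Summable fun i : CuspIndex N => cuspWeight χ s i * cuspIntegral f i *
      cexp (2 * π * I * n * ((i.2 : ℕ) / i.1 : ℝ)) := by
    refine Summable.of_norm ((summable_norm_cuspWeight_mul_integral f χ hs).congr fun i => ?_)
    rw [norm_mul _ (cexp _), norm_exp_two_pi_mul, mul_one]
  have h1 := hw.hasSum.mul_left (𝓕 (imPow s z.im) n * cexp (2 * π * I * n * z.re) * I)
  have h2 : (if n = 0 then eisensteinCoeff f χ s 0 * (z.im : ℂ) ^ (1 - s)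
      else eisensteinCoeff f χ s n * whittakerW s n z) =
      𝓕 (imPow s z.im) n * cexp (2 * π * I * n * z.re) * I * symbolSeries f χ s n := by
    split_ifs with hn
    · subst hn
      rw [eisensteinCoeff, if_pos rfl, Int.cast_zero, fourier_imPow_zero (by linarith) z.im_pos]
      simp
      ring
    · rw [eisensteinCoeff, if_neg hn, fourier_imPow_of_ne_zero (by linarith) hn]
      ring
  rw [h2, symbolSeries]
  refine h1.congr_fun fun i => ?_
  simp only [Function.comp, hu, Equiv.prodComm_apply, Prod.swap]
  rw [ofReal_add, mul_add, Complex.exp_add]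
  ring

omit [NeZero N] hs in
/-- At each height `y` the expansion is a trigonometric series in `x`, whose coefficients are
unique; the height can be chosen such that `K_{s-1/2}(2π|n|y)` is not zero. -/
theorem HasFourierExpansion.unique {E : ℍ → ℂ} (hs : 1 / 2 < s.re) {φ φ' : ℤ → ℂ}
    (h : HasFourierExpansion E s φ) (h' : HasFourierExpansion E s φ') : φ = φ' := by
  set a : ℝ → ℤ → ℂ := fun y n => if n = 0 then (φ 0 - φ' 0) * (y : ℂ) ^ (1 - s) else
    (φ n - φ' n) * (2 * ((Real.sqrt (|(n : ℝ)| * y) : ℝ) : ℂ) *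
      besselK (s - 1 / 2) (2 * π * |(n : ℝ)| * y)) with ha
  have hz : ∀ y : ℝ, 0 < y → ∀ x : ℝ,
      HasSum (fun n : ℤ => a y n * cexp (2 * π * I * n * x)) 0 := by
    intro y hy x
    have h1 := (h ⟨x + y * I, by simpa using hy⟩).sub (h' ⟨x + y * I, by simpa using hy⟩)
    rw [sub_self] at h1
    refine h1.congr_fun fun n => ?_
    have hre : (⟨x + y * I, by simpa using hy⟩ : ℍ).re = x := by simp [UpperHalfPlane.re]
    have him : (⟨x + y * I, by simpa using hy⟩ : ℍ).im = y := by simp [UpperHalfPlane.im]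
    simp only [ha]
    split_ifs with hn
    · subst hn
      rw [him]
      simp
      ring
    · rw [whittakerW, hre, him]
      ring
  have ha0 : ∀ y : ℝ, 0 < y → ∀ n, a y n = 0 := by
    intro y hy n
    refine trigSeries_unique (c := a y) (k := fun n => n) ?_ Function.injective_id
      (fun x => hz y hy x) n
    simpa using (hz y hy 0).summable
  ext n
  rcases eq_or_ne n 0 with rfl | hn
  · have h1 := ha0 1 one_pos 0
    simpa [ha, sub_eq_zero] using h1
  · have hn' : 0 < |(n : ℝ)| := abs_pos.mpr (by exact_mod_cast hn)
    obtain ⟨y, hy, hK⟩ := exists_besselK_ne_zero (ν := s - 1 / 2) (b := 2 * π * |(n : ℝ)|)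
      (by norm_num; linarith) (by positivity)
    have h1 := ha0 y hy n
    simp only [ha, if_neg hn] at h1
    have h2 : ((√(|(n : ℝ)| * y) : ℝ) : ℂ) ≠ 0 := by
      have : 0 < √(|(n : ℝ)| * y) := Real.sqrt_pos.mpr (by positivity)
      exact_mod_cast this.ne'
    rcases mul_eq_zero.mp h1 with h3 | h3
    · exact sub_eq_zero.mp h3
    · exact absurd h3 (mul_ne_zero (mul_ne_zero two_ne_zero h2) hK)

end FourierExpansion

/-! ### The shifted convolution sums and the twisted `L`-function -/

section Continuation

variable {N : ℕ}

theorem HasContinuedValue.const_mul {b : ℕ → ℂ} {σ₀ : ℝ} {t₀ v : ℂ}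
    (h : HasContinuedValue b σ₀ t₀ v) (r : ℂ) :
    HasContinuedValue (fun l => r * b l) σ₀ t₀ (r * v) := by
  obtain ⟨σ₁, h₁, G, hG, hs, rfl⟩ := h
  exact ⟨σ₁, h₁, fun t => r * G t, hG.const_mul r, fun t ht => (hs t ht).smul r, rfl⟩

/-- The coefficient of index `0` plays no role in a Dirichlet series. -/
theorem HasContinuedValue.congr {b b' : ℕ → ℂ} {σ₀ : ℝ} {t₀ v : ℂ}
    (h : HasContinuedValue b σ₀ t₀ v) (hb : ∀ l ≠ 0, b l = b' l) :
    HasContinuedValue b' σ₀ t₀ v := by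
  obtain ⟨σ₁, h₁, G, hG, hs, rfl⟩ := h
  refine ⟨σ₁, h₁, G, hG, fun t ht => ?_, rfl⟩
  refine (hs t ht).congr_fun fun l => ?_
  rcases eq_or_ne l 0 with rfl | hl
  · simp
  · rw [LSeries.term_of_ne_zero hl, LSeries.term_of_ne_zero hl, hb l hl]

variable [NeZero N] (f : CuspForm2 N) {χ : DirichletCharacter ℂ N} {s : ℂ}

/-- Unfolding the integrals along the vertical lines, the phase `e(nd/c)` of the symbol series
combines with the phases `e(-ld/c)` of the Fourier expansion of `f` to Ramanujan sums. -/
theorem hasContinuedValue_symbolSeries (χ : DirichletCharacter ℂ N) (hs : 2 < s.re) (n : ℤ) :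
    HasContinuedValue (fun l => cuspCoeff f l * LSeries (charSum (star χ) (n - l)) (2 * s))
      (3 / 2) 1 (2 * π * symbolSeries f χ s n) := by
  obtain ⟨C, hC, hb⟩ := exists_cuspIndex_bound f
  have hw : Summable fun i : CuspIndex N =>
      ‖cuspWeight χ s i * cexp (2 * π * I * n * ((i.2 : ℕ) / i.1 : ℝ))‖ *
        ((C + 1) * (i.1 : ℝ) ^ 2) := by
    simp only [norm_mul, norm_exp_two_pi_mul, mul_one]
    refine ((summable_norm_cuspWeight_mul_sq χ hs).mul_left (C + 1)).congr fun i => ?_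
    ring
  have h := hasContinuedValue_tsum_cuspLine f (x := fun i : CuspIndex N => -((i.2 : ℕ) / i.1))
    (fun i => by nlinarith [one_le_cuspIndex_sq i])
    (fun i y hy => (hb i y hy).trans (by nlinarith [one_le_cuspIndex_sq i])) hw
  have hv : ∑' i : CuspIndex N, cuspWeight χ s i * cexp (2 * π * I * n * ((i.2 : ℕ) / i.1 : ℝ)) *
      ∫ y in Set.Ioi (0 : ℝ), cuspLine f (-((i.2 : ℕ) / i.1)) y = symbolSeries f χ s n :=
    tsum_congr fun i => by rw [cuspIntegral]; ring
  rw [hv] at h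
  refine h.congr fun l _ => ?_
  have h2 : 2 < (2 * s).re := by simp; linarith
  rw [← tsum_cuspIndex_charSum _ _ h2]
  congr 1
  refine tsum_congr fun i => ?_
  rw [cuspWeight, mul_assoc, ← Complex.exp_add]
  congr 2
  push_cast
  ring

omit [NeZero N] in
theorem dirichletL_ne_zero (ψ : DirichletCharacter ℂ N) {t : ℂ} (ht : 1 < t.re) :
    dirichletL ψ t ≠ 0 :=
  DirichletCharacter.LSeries_ne_zero_of_one_lt_re ψ ht

/-- `dirichletL_mul_LSeries_charSum`, solved for the divisor sum. -/
theorem LSeries_charSum_eq (hprim : χ.IsPrimitive) (heven : χ.Even) {m : ℤ} (hm : m ≠ 0) {t : ℂ}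
    (ht : 2 < t.re) :
    sigmaChi χ (t - 1) m.natAbs / (m.natAbs : ℂ) ^ (t - 1) =
      (N : ℂ) ^ t * dirichletL (star χ) t / gaussSum (star χ) ZMod.stdAddChar *
        LSeries (charSum (star χ) m) t := by
  have hW := gaussSum_ne_zero_of_isPrimitive _ (isPrimitive_star χ hprim)
  have hN : (N : ℂ) ^ t ≠ 0 := by simp [cpow_eq_zero_iff, NeZero.ne N]
  rw [div_mul_eq_mul_div, mul_assoc, dirichletL_mul_LSeries_charSum hprim heven hm ht]
  field_simp

theorem hasContinuedValue_shiftedCoeff (hprim : χ.IsPrimitive) (heven : χ.Even) (hs : 2 < s.re)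
    (n : ℤ) : HasContinuedValue (shiftedCoeff f χ n s) (3 / 2) 1
      ((N : ℂ) ^ (2 * s) * dirichletL (star χ) (2 * s) / gaussSum (star χ) ZMod.stdAddChar *
        (2 * π * symbolSeries f χ s n)) := by
  have h2 : 2 < (2 * s).re := by simp; linarith
  refine ((hasContinuedValue_symbolSeries f χ hs n).const_mul _).congr fun l _ => ?_
  rw [shiftedCoeff]
  split_ifs with hl
  · -- for `l = n` the two sides agree because the term vanishes: for `N = 1` there are no cusp
    -- forms, and otherwise `∑ χ̄(d)` over the residues prime to `c` is zero
    rw [show n - l = 0 by linarith]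
    by_cases hN : N = 1
    · subst hN
      have : cuspCoeff f l = 0 := by
        rw [cuspForm_level_one_eq_zero f, cuspCoeff, FunLike.coe_zero, qExpansion_zero, map_zero]
      rw [this]
      ring
    · rw [LSeries_charSum_zero hN hprim h2]
      ring
  · rw [show ((l : ℤ) - n).natAbs = (n - l).natAbs by omega, mul_div_assoc (cuspCoeff f l),
      LSeries_charSum_eq hprim heven (by omega) h2]
    ring

/-- The `n`-th Fourier coefficient and the shifted convolution sum are multiples of the same
symbol series. -/
theorem shiftedConvolution_eq (hprim : χ.IsPrimitive) (heven : χ.Even) (hs : 2 < s.re) {n : ℤ}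
    (hn : n ≠ 0) : shiftedConvolution f χ n s =
      2 * Complex.Gamma s * (N : ℂ) ^ (2 * s) * dirichletL (star χ) (2 * s) /
        (Complex.I * gaussSum (star χ) ZMod.stdAddChar *
          ((Real.pi * |(n : ℝ)| : ℝ) : ℂ) ^ (s - 1)) * eisensteinCoeff f χ s n := by
  have hW := gaussSum_ne_zero_of_isPrimitive _ (isPrimitive_star χ hprim)
  have hG : Gamma s ≠ 0 := Gamma_ne_zero_of_re_pos (by linarith)
  have hn0 : (0 : ℝ) < |(n : ℝ)| := by positivity
  have hpi : (π : ℂ) ≠ 0 := by exact_mod_cast Real.pi_pos.ne'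
  rw [shiftedConvolution, (hasContinuedValue_shiftedCoeff f hprim heven hs n).continuedValue_eq,
    eisensteinCoeff, if_neg hn, ofReal_mul, mul_cpow_ofReal_nonneg Real.pi_pos.le hn0.le,
    show (π : ℂ) ^ s = (π : ℂ) ^ (s - 1) * π by
      rw [cpow_sub _ _ hpi, cpow_one]; field_simp]
  have h1 : (π : ℂ) ^ (s - 1) ≠ 0 := by simp [cpow_eq_zero_iff, hpi]
  have h2 : ((|(n : ℝ)| : ℝ) : ℂ) ^ (s - 1) ≠ 0 := by
    simp [cpow_eq_zero_iff, hn]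
  field_simp

/-- Expanding `χ` by its Gauss sum writes the twisted series in terms of the values of `f` above
the cusps `-u/N`, `u` prime to `N`. -/
theorem exists_hasContinuedValue_twistCoeff (hprim : χ.IsPrimitive) (heven : χ.Even) :
    ∃ v, HasContinuedValue (twistCoeff f χ) (3 / 2) 1 v := by
  obtain ⟨C, hC, hb⟩ := exists_cuspIndex_bound f
  have h := hasContinuedValue_tsum_cuspLine f (ι := cuspResidues N N)
    (w := fun u => (star χ) (u : ℕ)) (x := fun u => -((u : ℕ) / N)) (M := fun _ => (C + 1) * N ^ 2)
    (fun u => by nlinarith [one_le_cuspIndex_sq (N := N) ⟨N, u⟩])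
    (fun u y hy => (hb ⟨N, u⟩ y hy).trans
      (by nlinarith [one_le_cuspIndex_sq (N := N) ⟨N, u⟩])) Summable.of_finite
  have hW := gaussSum_ne_zero_of_isPrimitive _ (isPrimitive_star χ hprim)
  refine ⟨_, (h.const_mul (gaussSum (star χ) ZMod.stdAddChar)⁻¹).congr fun l _ => ?_⟩
  have h1 : ∑ u ∈ cuspResidues N N, (star χ) u * cexp (2 * π * I * (-l : ℤ) * u / N) =
      χ l * gaussSum (star χ) ZMod.stdAddChar := by
    have h2 : χ ((-(l : ℤ) : ℤ) : ZMod N) = χ l := by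
      rw [Int.cast_neg, Int.cast_natCast, ← neg_one_mul, map_mul]
      have : χ (-1) = 1 := heven
      rw [this, one_mul]
    have h3 := sum_range_char_mul_exp (star χ) (isPrimitive_star χ hprim) (-l)
    rw [MulChar.star_eq_inv, inv_inv, ← MulChar.star_eq_inv] at h3
    rw [← h2, ← h3]
    refine Finset.sum_subset (fun u hu => Finset.mem_range.mpr (mem_cuspResidues.mp hu).2.1)
      fun u hu hu' => ?_
    rw [MulChar.map_nonunit, zero_mul]
    rw [ZMod.isUnit_iff_coprime]
    exact fun hc => hu' (mem_cuspResidues.mpr ⟨dvd_rfl, Finset.mem_range.mp hu, hc.symm⟩)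
  rw [twistCoeff, tsum_fintype, Finset.sum_coe_sort (cuspResidues N N)
    (fun u : ℕ => (star χ) u * cexp (2 * π * I * l * (-((u : ℕ) / N) : ℝ)))]
  have h4 : ∑ u ∈ cuspResidues N N, (star χ) u * cexp (2 * π * I * l * (-((u : ℕ) / N) : ℝ)) =
      χ l * gaussSum (star χ) ZMod.stdAddChar := by
    rw [← h1]
    refine Finset.sum_congr rfl fun u _ => ?_
    push_cast
    congr 2
    ring
  rw [h4]
  field_simp

end Continuation

/-! ### Hecke eigenforms -/

section Hecke

/-- The effect of `T_p` on Fourier coefficients. -/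
theorem cuspCoeff_of_heckeT {N : ℕ} [NeZero N] (f : CuspForm2 N) {p : ℕ} (hp : 0 < p) {c : ℂ}
    (h : ∀ z : ℍ, heckeT p f z = c * f z) (m : ℕ) :
    (if p ∣ m then p * cuspCoeff f (m / p) else 0) + cuspCoeff f (p * m) = c * cuspCoeff f m := by
  have hp' : (0 : ℝ) < p := by exact_mod_cast hp
  have hpC : (p : ℂ) ≠ 0 := by exact_mod_cast hp.ne'
  have hinj : Function.Injective fun l : ℕ => p * l := fun _ _ h => Nat.eq_of_mul_eq_mul_left hp h
  let b : ℕ → ℂ := fun m => (if p ∣ m then p * cuspCoeff f (m / p) else 0) +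
    cuspCoeff f (p * m) - c * cuspCoeff f m
  -- the coefficients are compared at height `y = 1`
  let r : ℕ → ℂ := fun m => ((Real.exp (-(2 * π * m) * 1) : ℝ) : ℂ)
  have hr (m : ℕ) : r m ≠ 0 := by simp only [r]; exact_mod_cast (Real.exp_pos _).ne'
  have key : ∀ x : ℝ, HasSum (fun m : ℕ => b m * r m * cexp (2 * π * I * (m : ℤ) * x)) 0 := by
    intro x
    -- the term `p f(pz)`
    have h1 : HasSum (fun m : ℕ => (if p ∣ m then p * cuspCoeff f (m / p) else 0) * r m *
        cexp (2 * π * I * (m : ℤ) * x)) (p * cuspLine f (p * x) (p * 1)) := by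
      rw [← hinj.hasSum_iff]
      · refine ((hasSum_cuspLine f (p * x) (y := p * 1) (by positivity)).mul_left
          (p : ℂ)).congr_fun fun l => ?_
        simp only [Function.comp, dvd_mul_right, if_true, Nat.mul_div_cancel_left _ hp, r]
        rw [show (-(2 * π * ((p * l : ℕ) : ℝ)) * 1) = -(2 * π * l) * (p * 1) by push_cast; ring,
          show (2 * π * I * ((p * l : ℕ) : ℤ) * x : ℂ) = 2 * π * I * l * (p * x : ℝ) by
            push_cast; ring]
        ring
      · intro m hm
        rw [if_neg, zero_mul, zero_mul]
        rintro ⟨l, rfl⟩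
        exact hm ⟨l, rfl⟩
    -- the average of the `f((z + b) / p)` picks out the coefficients of index divisible by `p`
    have h2 : HasSum (fun m : ℕ => cuspCoeff f (p * m) * r m * cexp (2 * π * I * (m : ℤ) * x))
        ((p : ℂ)⁻¹ * ∑ b ∈ Finset.range p, cuspLine f ((x + b) / p) (1 / p)) := by
      have h3 := (hasSum_sum fun (b : ℕ) (_ : b ∈ Finset.range p) =>
        hasSum_cuspLine f ((x + b) / p) (y := 1 / p) (by positivity)).mul_left (p : ℂ)⁻¹
      rw [← hinj.hasSum_iff] at h3
      · refine h3.congr_fun fun m => ?_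
        simp only [Function.comp, r]
        have h4 : ∀ b ∈ Finset.range p, cuspCoeff f (p * m) *
            cexp (2 * π * I * (p * m : ℕ) * ((x + b) / p : ℝ)) *
              (Real.exp (-(2 * π * (p * m : ℕ)) * (1 / p)) : ℝ) =
            cuspCoeff f (p * m) * (Real.exp (-(2 * π * m) * 1) : ℝ) *
              cexp (2 * π * I * (m : ℤ) * x) := by
          intro b _
          rw [show (-(2 * π * (p * m : ℕ)) * (1 / p) : ℝ) = -(2 * π * m) * 1 by
            push_cast; field_simp]
          have h5 : cexp (2 * π * I * (p * m : ℕ) * ((x + b) / p : ℝ)) =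
              cexp (2 * π * I * (m : ℤ) * x) := by
            rw [Complex.exp_eq_exp_iff_exists_int]
            refine ⟨m * b, ?_⟩
            push_cast
            field_simp
          rw [h5]
          ring
        rw [Finset.sum_congr rfl h4, Finset.sum_const, Finset.card_range, nsmul_eq_mul]
        field_simp
      · intro l hl
        have hl' : ¬ (p : ℤ) ∣ l := by
          intro hd
          obtain ⟨k, rfl⟩ := Int.natCast_dvd_natCast.mp hd
          exact hl ⟨k, rfl⟩
        have h4 := sum_range_exp_mul_div l hp
        rw [if_neg hl'] at h4
        refine mul_eq_zero_of_right _ ?_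
        calc _ = cuspCoeff f l * cexp (2 * π * I * l * (x / p)) *
              (Real.exp (-(2 * π * l) * (1 / p)) : ℝ) *
              ∑ b ∈ Finset.range p, cexp (2 * π * I * (l : ℤ) * b / p) := by
              rw [Finset.mul_sum]
              refine Finset.sum_congr rfl fun b _ => ?_
              rw [show (2 * π * I * l * ((x + b) / p : ℝ) : ℂ) =
                2 * π * I * l * (x / p) + 2 * π * I * (l : ℤ) * b / p by push_cast; ring,
                Complex.exp_add]
              ring
          _ = 0 := by rw [h4, mul_zero]
    have h6 := (h1.add h2).sub ((hasSum_cuspLine f x (y := 1) one_pos).mul_left c)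
    have h7 : p * cuspLine f (p * x) (p * 1) +
        (p : ℂ)⁻¹ * ∑ b ∈ Finset.range p, cuspLine f ((x + b) / p) (1 / p) -
        c * cuspLine f x 1 = 0 := by
      have hz := h (ofComplex (x + (1 : ℝ) * I))
      have hcoe : (ofComplex (x + (1 : ℝ) * I) : ℂ) = x + (1 : ℝ) * I := by
        rw [ofComplex_mk one_pos]
      rw [heckeT, hcoe] at hz
      rw [sub_eq_zero]
      refine Eq.trans ?_ hz
      congr 2
      · rw [cuspLine]
        congr 2
        push_cast
        ring
      · congr 1
        funext b
        rw [cuspLine]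
        congr 2
        push_cast
        ring
    rw [h7] at h6
    refine h6.congr_fun fun m => ?_
    simp only [b, r, Int.cast_natCast]
    ring
  have hsum : Summable fun m => b m * r m := by simpa using (key 0).summable
  have h8 := trigSeries_unique hsum (k := fun m : ℕ => (m : ℤ)) Nat.cast_injective key m
  exact sub_eq_zero.mp ((mul_eq_zero.mp h8).resolve_right (hr m))

end Hecke

section HeckeRelations

/-- The Hecke relations in weight two at the primes not dividing `N`, for a sequence normalized by
`a(1) = 1`: `a(p) a(m) = a(pm) + p a(m/p)`, where `a(m/p) = 0` unless `p ∣ m`. -/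
def HeckeRelations (N : ℕ) (a : ℕ → ℂ) : Prop :=
  a 1 = 1 ∧ ∀ p : ℕ, p.Prime → ¬ p ∣ N → ∀ m : ℕ,
    a p * a m = a (p * m) + if p ∣ m then p * a (m / p) else 0

theorem IsNormalizedEigenform.heckeRelations {N : ℕ} [NeZero N] {f : CuspForm2 N}
    (hf : IsNormalizedEigenform f) : HeckeRelations N (cuspCoeff f) := by
  refine ⟨hf.1, fun p hp hpN m => ?_⟩
  obtain ⟨c, hc⟩ := hf.2 p hp hpN
  have h := cuspCoeff_of_heckeT f hp.pos hc
  have h1 := h 1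
  rw [if_neg (by simpa using hp.one_lt.ne'), hf.1, zero_add, mul_one, mul_one] at h1
  rw [h1, ← h m, add_comm]

variable {N : ℕ} {a : ℕ → ℂ}

/-- The function supported on the squares `g²`, with the values `χ(g) g^{w+1}`. -/
noncomputable def squareCoeff (χ : DirichletCharacter ℂ N) (w : ℂ) (k : ℕ) : ℂ :=
  if IsSquare k then χ (Nat.sqrt k) * (Nat.sqrt k * (Nat.sqrt k : ℂ) ^ w) else 0

namespace HeckeRelations

theorem mul_of_not_dvd (ha : HeckeRelations N a) {p : ℕ} (hp : p.Prime) (hpN : ¬ p ∣ N) {m : ℕ}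
    (hm : ¬ p ∣ m) (r : ℕ) : a (p ^ r) * a m = a (p ^ r * m) := by
  induction r using Nat.strong_induction_on with
  | _ r ih =>
    match r with
    | 0 => simp [ha.1]
    | 1 => simp [ha.2 p hp hpN m, hm]
    | r + 2 =>
      have h1 := ha.2 p hp hpN (p ^ (r + 1))
      have h2 := ha.2 p hp hpN (p ^ (r + 1) * m)
      rw [if_pos (dvd_pow_self p (by omega)), pow_succ, Nat.mul_div_cancel _ hp.pos] at h1
      rw [if_pos (dvd_mul_of_dvd_left (dvd_pow_self p (by omega)) m), pow_succ, mul_right_comm,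
        Nat.mul_div_cancel _ hp.pos] at h2
      have h3 := ih r (by omega)
      have h4 := ih (r + 1) (by omega)
      rw [pow_succ, mul_right_comm] at h4
      rw [show p ^ (r + 2) = p * (p ^ r * p) by ring,
        show p * (p ^ r * p) * m = p * (p ^ r * m * p) by ring]
      linear_combination (-a m) * h1 + h2 + a p * h4 - p * h3

theorem pow_succ_mul (ha : HeckeRelations N a) {p : ℕ} (hp : p.Prime) (hpN : ¬ p ∣ N) (r m : ℕ) :
    a (p ^ (r + 1)) * a (p * m) = a (p ^ (r + 1) * (p * m)) + p * (a (p ^ r) * a m) := by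
  induction r generalizing m with
  | zero =>
    have h := ha.2 p hp hpN (p * m)
    rw [if_pos (dvd_mul_right p m), Nat.mul_div_cancel_left _ hp.pos] at h
    simpa [ha.1] using h
  | succ r ih =>
    have h1 := ha.2 p hp hpN (p ^ (r + 1))
    have h2 := ha.2 p hp hpN (p * m)
    have h3 := ih (p * m)
    rw [if_pos (dvd_pow_self p (by omega)), pow_succ, Nat.mul_div_cancel _ hp.pos] at h1
    rw [if_pos (dvd_mul_right p m), Nat.mul_div_cancel_left _ hp.pos] at h2
    rw [pow_succ] at h3
    rw [show p ^ (r + 1 + 1) = p * (p ^ r * p) by ring, pow_succ,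
      show p * (p ^ r * p) * (p * m) = p ^ r * p * (p * (p * m)) by ring]
    linear_combination (-a (p * m)) * h1 + a (p ^ r * p) * h2 + h3

/-- The Hecke relations at a prime power. -/
theorem prime_pow_mul (ha : HeckeRelations N a) {p : ℕ} (hp : p.Prime) (hpN : ¬ p ∣ N) (r e : ℕ) :
    a (p ^ r) * a e = ∑ g ∈ (Nat.gcd (p ^ r) e).divisors, g * a (p ^ r * e / g ^ 2) := by
  induction r generalizing e with
  | zero => simp [ha.1]
  | succ r ih =>
    by_cases he : p ∣ e
    · obtain ⟨m, rfl⟩ := he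
      obtain ⟨k, -, hk⟩ := (Nat.dvd_prime_pow hp).mp (Nat.gcd_dvd_left (p ^ r) m)
      have hk' : Nat.gcd (p ^ (r + 1)) (p * m) = p ^ (k + 1) := by
        rw [pow_succ', Nat.gcd_mul_left, hk, pow_succ']
      rw [ha.pow_succ_mul hp hpN, ih m, hk, hk',
        Nat.sum_divisors_prime_pow hp, Nat.sum_divisors_prime_pow hp, Finset.sum_range_succ' _ (k + 1),
        Finset.mul_sum, add_comm]
      congr 1
      · refine Finset.sum_congr rfl fun j _ => ?_
        rw [show p ^ (r + 1) * (p * m) = p ^ 2 * (p ^ r * m) by ring,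
          show (p ^ (j + 1)) ^ 2 = p ^ 2 * (p ^ j) ^ 2 by ring,
          Nat.mul_div_mul_left _ _ (pow_pos hp.pos 2)]
        push_cast
        ring
      · simp
    · have h1 : Nat.gcd (p ^ (r + 1)) e = 1 := ((Nat.Prime.coprime_iff_not_dvd hp).mpr he).pow_left _
      rw [h1, ha.mul_of_not_dvd hp hpN he]
      simp

open scoped Pointwise in
/-- The Hecke relations at all integers prime to the level. -/
theorem mul_eq (ha : HeckeRelations N a) {d : ℕ} (hd0 : d ≠ 0) (hd : d.Coprime N) {e : ℕ}
    (he : e ≠ 0) : a d * a e = ∑ g ∈ (Nat.gcd d e).divisors, g * a (d * e / g ^ 2) := by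
  induction d using Nat.recOnPosPrimePosCoprime generalizing e with
  | zero => exact absurd rfl hd0
  | one => simp [ha.1]
  | prime_pow p r hp hr =>
    exact ha.prime_pow_mul hp (hp.coprime_iff_not_dvd.mp (Nat.Coprime.coprime_dvd_left
      (dvd_pow_self p hr.ne') hd)) r e
  | coprime x y hx hy hxy ihx ihy =>
    have hx0 : x ≠ 0 := by omega
    have hy0 : y ≠ 0 := by omega
    have h1 := fun {e : ℕ} => @ihx hx0 (hd.coprime_mul_right) e
    have h2 := fun {e : ℕ} => @ihy hy0 (hd.coprime_mul_left) e
    have h3 : a (x * y) = a x * a y := by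
      rw [h1 hy0, hxy]
      simp
    have hdiv : (Nat.gcd (x * y) e).divisors = (Nat.gcd x e).divisors * (Nat.gcd y e).divisors := by
      rw [← Nat.divisors_mul, Nat.gcd_comm, hxy.gcd_mul, Nat.gcd_comm e x, Nat.gcd_comm e y]
    have hcop : (Nat.gcd x e).Coprime (Nat.gcd y e) :=
      (hxy.coprime_dvd_left (Nat.gcd_dvd_left x e)).coprime_dvd_right (Nat.gcd_dvd_left y e)
    rw [h3, mul_assoc, h2 he, hdiv, Finset.mul_def, Finset.sum_image hcop.mul_injOn_divisors,
      Finset.sum_product_right, Finset.mul_sum]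
    refine Finset.sum_congr rfl fun g hg => ?_
    have hg' : g ∣ Nat.gcd y e := Nat.dvd_of_mem_divisors hg
    obtain ⟨q, hq⟩ : g ^ 2 ∣ y * e := by
      rw [sq]
      exact mul_dvd_mul (hg'.trans (Nat.gcd_dvd_left y e)) (hg'.trans (Nat.gcd_dvd_right y e))
    have hg0 : 0 < g ^ 2 := pow_pos (Nat.pos_of_mem_divisors hg) 2
    have hq0 : q ≠ 0 := by
      rintro rfl
      exact mul_ne_zero hy0 he hq
    -- `x` is prime to `y`, so the factors `y` and `g` do not affect the greatest common divisor
    have hgcd : Nat.gcd x q = Nat.gcd x e := by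
      have hxg : x.Coprime (g ^ 2) :=
        (hxy.coprime_dvd_right (hg'.trans (Nat.gcd_dvd_left y e))).pow_right 2
      rw [← Nat.Coprime.gcd_mul_left_cancel_right q hxg.symm, ← hq,
        Nat.Coprime.gcd_mul_left_cancel_right e hxy.symm]
    rw [hq, Nat.mul_div_cancel_left _ hg0, mul_left_comm, h1 hq0, hgcd, Finset.mul_sum]
    refine Finset.sum_congr rfl fun g' _ => ?_
    rw [mul_assoc x y e, hq, show x * (g ^ 2 * q) = g ^ 2 * (x * q) by ring,
      show (g' * g) ^ 2 = g ^ 2 * g' ^ 2 by ring, Nat.mul_div_mul_left _ _ hg0]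
    push_cast
    ring

variable (χ : DirichletCharacter ℂ N) (w : ℂ)

/-- The twisted divisor sum as a sum over factorizations `l = de`. -/
theorem mul_sigmaChi (l : ℕ) : (l : ℂ) ^ w * sigmaChi χ (-w) l =
    ∑ p ∈ l.divisorsAntidiagonal, χ p.1 * (p.2 : ℂ) ^ w := by
  rw [Nat.sum_divisorsAntidiagonal (fun d e => χ d * (e : ℂ) ^ w), sigmaChi, Finset.mul_sum]
  refine Finset.sum_congr rfl fun d hd => ?_
  obtain ⟨⟨e, rfl⟩, hl⟩ := Nat.mem_divisors.mp hd
  have hd0 : d ≠ 0 := by rintro rfl; simp at hl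
  have h1 : (d : ℂ) ^ w ≠ 0 := by simp [cpow_eq_zero_iff, hd0]
  rw [Nat.mul_div_cancel_left _ (Nat.pos_of_ne_zero hd0), Nat.cast_mul, natCast_mul_natCast_cpow,
    cpow_neg]
  field_simp

open scoped LSeries.notation in
/-- Summing the Hecke relations for `a(d') a(e')` against `χ(d') e'^w`, and substituting
`d' = gd`, `e' = ge`. -/
theorem convolution_eq (ha : HeckeRelations N a) :
    (fun d => a d * χ d) ⍟ (fun e => a e * (e : ℂ) ^ w) =
      squareCoeff χ w ⍟ fun l => a l * ((l : ℂ) ^ w * sigmaChi χ (-w) l) := by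
  funext n
  simp only [LSeries.convolution_def, mul_sigmaChi, squareCoeff, ite_mul, zero_mul]
  have h1 : ∀ p ∈ n.divisorsAntidiagonal, a p.1 * χ p.1 * (a p.2 * (p.2 : ℂ) ^ w) =
      ∑ g ∈ (Nat.gcd p.1 p.2).divisors, g * a (n / g ^ 2) * (χ p.1 * (p.2 : ℂ) ^ w) := by
    intro p hp
    obtain ⟨hp, hn⟩ := Nat.mem_divisorsAntidiagonal.mp hp
    by_cases hc : Nat.Coprime p.1 N
    · rw [← Finset.sum_mul, ← hp, ← ha.mul_eq (by rintro h; simp [h] at hp; omega) hc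
        (by rintro h; simp [h] at hp; omega)]
      ring
    · have : χ p.1 = 0 := MulChar.map_nonunit _ fun h => hc ((ZMod.isUnit_iff_coprime _ _).mp h)
      simp [this]
  rw [Finset.sum_congr rfl h1, ← Finset.sum_filter]
  simp only [Finset.mul_sum]
  rw [Finset.sum_sigma', Finset.sum_sigma']
  refine Finset.sum_bij'
    (fun x _ => ⟨(x.2 * x.2, (x.1.1 / x.2) * (x.1.2 / x.2)), (x.1.1 / x.2, x.1.2 / x.2)⟩)
    (fun y _ => ⟨(Nat.sqrt y.1.1 * y.2.1, Nat.sqrt y.1.1 * y.2.2), Nat.sqrt y.1.1⟩) ?_ ?_ ?_ ?_ ?_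
  · rintro ⟨⟨d, e⟩, g⟩ h
    simp only [Finset.mem_sigma, Nat.mem_divisorsAntidiagonal, Nat.mem_divisors, Nat.dvd_gcd_iff,
      Finset.mem_filter] at h ⊢
    obtain ⟨⟨rfl, hn⟩, ⟨⟨d, rfl⟩, ⟨e, rfl⟩⟩, h0⟩ := h
    have hg : 0 < g := Nat.pos_of_ne_zero (by rintro rfl; simp at hn)
    simp only [Nat.mul_div_cancel_left _ hg]
    refine ⟨⟨⟨by ring, hn⟩, ⟨g, rfl⟩⟩, trivial, ?_⟩
    rintro h
    exact hn (by rw [show g * d * (g * e) = g * g * (d * e) by ring, h, mul_zero])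
  · rintro ⟨⟨k, l⟩, ⟨d, e⟩⟩ h
    simp only [Finset.mem_sigma, Nat.mem_divisorsAntidiagonal, Nat.mem_divisors, Nat.dvd_gcd_iff,
      Finset.mem_filter] at h ⊢
    obtain ⟨⟨⟨hn, hn0⟩, ⟨g, rfl⟩⟩, rfl, h0⟩ := h
    rw [Nat.sqrt_eq]
    refine ⟨⟨by rw [← hn]; ring, hn0⟩, ⟨dvd_mul_right _ _, dvd_mul_right _ _⟩, ?_⟩
    rw [Nat.gcd_mul_left]
    intro h
    rcases Nat.mul_eq_zero.mp h with rfl | h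
    · simp at hn; omega
    · rw [Nat.gcd_eq_zero_iff] at h
      simp [h] at h0
  · rintro ⟨⟨d, e⟩, g⟩ h
    simp only [Finset.mem_sigma, Nat.mem_divisorsAntidiagonal, Nat.mem_divisors, Nat.dvd_gcd_iff] at h
    obtain ⟨⟨rfl, hn⟩, ⟨⟨d, rfl⟩, ⟨e, rfl⟩⟩, h0⟩ := h
    have hg : 0 < g := Nat.pos_of_ne_zero (by rintro rfl; simp at hn)
    simp only [Nat.mul_div_cancel_left _ hg, Nat.sqrt_eq]
  · rintro ⟨⟨k, l⟩, ⟨d, e⟩⟩ h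
    simp only [Finset.mem_sigma, Nat.mem_divisorsAntidiagonal, Finset.mem_filter] at h
    obtain ⟨⟨⟨hn, hn0⟩, ⟨g, rfl⟩⟩, rfl, h0⟩ := h
    have hg : 0 < g := Nat.pos_of_ne_zero (by rintro rfl; simp at hn; omega)
    simp only [Nat.sqrt_eq, Nat.mul_div_cancel_left _ hg]
  · rintro ⟨⟨d, e⟩, g⟩ h
    simp only [Finset.mem_sigma, Nat.mem_divisorsAntidiagonal, Nat.mem_divisors, Nat.dvd_gcd_iff] at h
    obtain ⟨⟨rfl, hn⟩, ⟨⟨d, rfl⟩, ⟨e, rfl⟩⟩, h0⟩ := h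
    have hg : 0 < g := Nat.pos_of_ne_zero (by rintro rfl; simp at hn)
    simp only [Nat.mul_div_cancel_left _ hg, Nat.sqrt_eq]
    rw [show g * d * (g * e) = g ^ 2 * (d * e) by ring, Nat.mul_div_cancel_left _ (pow_pos hg 2),
      Nat.cast_mul, Nat.cast_mul, map_mul, natCast_mul_natCast_cpow]
    ring

end HeckeRelations

/-- Only squares contribute to the Dirichlet series of `squareCoeff χ w`. -/
theorem LSeriesHasSum_squareCoeff (χ : DirichletCharacter ℂ N) {w t : ℂ}
    (h : 1 < (2 * t - w - 1).re) :
    LSeriesHasSum (squareCoeff χ w) t (dirichletL χ (2 * t - w - 1)) := by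
  have hinj : Function.Injective fun g : ℕ => g * g := fun _ _ h => Nat.mul_self_inj.mp h
  rw [LSeriesHasSum, ← hinj.hasSum_iff]
  · refine (DirichletCharacter.LSeriesSummable_of_one_lt_re χ h).LSeriesHasSum.congr_fun fun g => ?_
    rcases eq_or_ne g 0 with rfl | hg
    · simp
    have hg' : (g : ℂ) ≠ 0 := by exact_mod_cast hg
    have h1 : (g : ℂ) ^ t ≠ 0 := by simp [cpow_eq_zero_iff, hg]
    have h2 : (g : ℂ) ^ w ≠ 0 := by simp [cpow_eq_zero_iff, hg]
    rw [Function.comp, LSeries.term_of_ne_zero (mul_ne_zero hg hg), LSeries.term_of_ne_zero hg,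
      squareCoeff, if_pos ⟨g, rfl⟩, Nat.sqrt_eq, Nat.cast_mul, natCast_mul_natCast_cpow,
      cpow_sub _ _ hg', cpow_sub _ _ hg', cpow_one, two_mul, cpow_add _ _ hg']
    field_simp
  · intro k hk
    rcases eq_or_ne k 0 with rfl | hk0
    · simp
    rw [LSeries.term_of_ne_zero hk0, squareCoeff, if_neg, zero_div]
    rintro ⟨g, rfl⟩
    exact hk ⟨g, rfl⟩

end HeckeRelations

/-! ### The constant term -/

section ConstantTerm

variable {N : ℕ}

theorem differentiableOn_LSeries_of_summable {b : ℕ → ℂ} {σ : ℝ}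
    (h : ∀ t : ℂ, σ < t.re → LSeriesSummable b t) :
    DifferentiableOn ℂ (LSeries b) {t | σ < t.re} := by
  have h1 : LSeries.abscissaOfAbsConv b ≤ σ :=
    LSeries.abscissaOfAbsConv_le_of_forall_lt_LSeriesSummable fun y hy => h y (by simpa using hy)
  exact (LSeries_differentiableOn b).mono fun t ht => lt_of_le_of_lt h1 (EReal.coe_lt_coe ht)

variable [NeZero N] {f : CuspForm2 N} {χ : DirichletCharacter ℂ N} {s : ℂ}

/-- For an eigenform, the Dirichlet series attached to the constant term factors by the Hecke
relations. -/
theorem hasContinuedValue_mul_sigmaChi (hf : IsNormalizedEigenform f) (hs : 2 < s.re)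
    (hsum : ∀ t : ℂ, 3 / 2 < t.re → LSeriesSummable
      (fun l => cuspCoeff f l * ((l : ℂ) ^ (1 - 2 * s) * sigmaChi χ (-(1 - 2 * s)) l)) t)
    {v : ℂ} (hv : HasContinuedValue (twistCoeff f χ) (3 / 2) 1 v) :
    HasContinuedValue
      (fun l => cuspCoeff f l * ((l : ℂ) ^ (1 - 2 * s) * sigmaChi χ (-(1 - 2 * s)) l)) (3 / 2) 1
      (v * cuspL f (2 * s) / dirichletL χ (2 * s)) := by
  obtain ⟨σ₁, h₁, G, hG, hGs, rfl⟩ := hv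
  have hL : ∀ t : ℂ, 1 / 2 < t.re → dirichletL χ (2 * t + 2 * s - 2) ≠ 0 := fun t ht =>
    dirichletL_ne_zero χ (by simp; linarith)
  -- both `L(f, t + 2s - 1)` and `L(χ, 2t + 2s - 2)⁻¹` are holomorphic for `Re t > 1/2`
  refine ⟨max σ₁ (1 / 2), max_lt h₁ (by norm_num),
    fun t => G t * cuspL f (t + 2 * s - 1) / dirichletL χ (2 * t + 2 * s - 2), ?_, ?_, ?_⟩
  · have hG' : DifferentiableOn ℂ G {t | max σ₁ (1 / 2) < t.re} :=
      hG.mono fun t ht => lt_of_le_of_lt (le_max_left σ₁ (1 / 2)) ht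
    refine (hG'.mul ?_).div ?_ fun t ht => hL t (lt_of_le_of_lt (le_max_right σ₁ (1 / 2)) ht)
    · refine (differentiableOn_LSeries_of_summable fun t ht =>
        LSeriesSummable_cuspCoeff f ht).comp (by fun_prop) fun t ht => ?_
      have := lt_of_le_of_lt (le_max_right _ _) (show max σ₁ (1 / 2) < t.re from ht)
      simp
      linarith
    · refine (differentiableOn_LSeries_of_summable fun t ht =>
        DirichletCharacter.LSeriesSummable_of_one_lt_re χ ht).comp (by fun_prop) fun t ht => ?_
      have := lt_of_le_of_lt (le_max_right _ _) (show max σ₁ (1 / 2) < t.re from ht)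
      simp
      linarith
  · intro t ht
    have h1 : LSeriesHasSum (fun e => cuspCoeff f e * (e : ℂ) ^ (1 - 2 * s)) t
        (cuspL f (t + 2 * s - 1)) := by
      refine (LSeriesSummable_cuspCoeff f (t := t + 2 * s - 1)
        (by simp; linarith)).LSeriesHasSum.congr_fun fun l => ?_
      rcases eq_or_ne l 0 with rfl | hl
      · simp
      have hl' : (l : ℂ) ≠ 0 := by exact_mod_cast hl
      rw [LSeries.term_of_ne_zero hl, LSeries.term_of_ne_zero hl, mul_div_assoc, ← cpow_sub _ _ hl',
        div_eq_mul_inv (cuspCoeff f l), ← cpow_neg]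
      congr 2
      ring
    have h2 : LSeriesHasSum (squareCoeff χ (1 - 2 * s)) t (dirichletL χ (2 * t + 2 * s - 2)) := by
      have := LSeriesHasSum_squareCoeff χ (w := 1 - 2 * s) (t := t) (by simp; linarith)
      convert this using 2
      ring
    have h3 := (hGs t ht).convolution h1
    have h4 := h2.convolution (hsum t ht).LSeriesHasSum
    rw [← hf.heckeRelations.convolution_eq] at h4
    have h5 := h3.unique h4
    have h6 := (hsum t ht).LSeriesHasSum
    rwa [← mul_div_cancel_left₀ (LSeries _ t) (hL t (by linarith)), ← h5] at h6
  · simp only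
    congr 3 <;> ring

/-- The continuation at `t = 1` of `∑ a(l) σ^χ_{2s-1}(l) l^{1-2s-t}` computed in two ways: from the
continuation of the symbol series for `n = 0`, and from the Hecke relations. -/
theorem symbolSeries_zero (hprim : χ.IsPrimitive) (heven : χ.Even) (hf : IsNormalizedEigenform f)
    (hs : 2 < s.re) {v : ℂ} (hv : HasContinuedValue (twistCoeff f χ) (3 / 2) 1 v) :
    (N : ℂ) ^ (2 * s) * dirichletL (star χ) (2 * s) / gaussSum (star χ) ZMod.stdAddChar *
      (2 * π * symbolSeries f χ s 0) = v * cuspL f (2 * s) / dirichletL χ (2 * s) := by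
  have h2 : 2 < (2 * s).re := by simp; linarith
  have h1 := ((hasContinuedValue_symbolSeries f χ hs 0).const_mul ((N : ℂ) ^ (2 * s) *
    dirichletL (star χ) (2 * s) / gaussSum (star χ) ZMod.stdAddChar)).congr
    (b' := fun l => cuspCoeff f l * ((l : ℂ) ^ (1 - 2 * s) * sigmaChi χ (-(1 - 2 * s)) l))
    fun l hl => by
      have h3 := LSeries_charSum_eq hprim heven (m := 0 - l) (by omega) h2
      rw [show (0 - (l : ℤ)).natAbs = l by omega] at h3
      rw [show -(1 - 2 * s) = 2 * s - 1 by ring, show 1 - 2 * s = -(2 * s - 1) by ring, cpow_neg,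
        ← div_eq_inv_mul, h3]
      ring
  obtain ⟨σ, hσ, G, hG, hGs, hG1⟩ := id h1
  exact h1.unique (hasContinuedValue_mul_sigmaChi hf hs
    (fun t ht => (hGs t ht).LSeriesSummable) hv)

end ConstantTerm

theorem mainTheorem3 (N : ℕ) [NeZero N] (f : CuspForm2 N) (χ : DirichletCharacter ℂ N)
    (hprim : χ.IsPrimitive) (heven : χ.Even) (s : ℂ) (hs : 2 < s.re) :
    -- the Eisenstein series converges absolutely and has a unique Fourier expansion
    (∀ z : ℍ, Summable (eisensteinCosetTerm f heven s z)) ∧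
    (∃! φ : ℤ → ℂ, HasFourierExpansion (eisensteinStar f heven s) s φ) ∧
    ∀ φ : ℤ → ℂ, HasFourierExpansion (eisensteinStar f heven s) s φ →
      -- the coefficients with `n ≠ 0`
      (∀ n : ℤ, n ≠ 0 →
        HasContinuedValue (shiftedCoeff f χ n s) (3 / 2) 1 (shiftedConvolution f χ n s) ∧
        shiftedConvolution f χ n s =
          2 * Complex.Gamma s * (N : ℂ) ^ (2 * s) * dirichletL (star χ) (2 * s) /
            (Complex.I * gaussSum (star χ) ZMod.stdAddChar *
              ((Real.pi * |(n : ℝ)| : ℝ) : ℂ) ^ (s - 1)) * φ n) ∧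
      -- the constant term
      (IsNormalizedEigenform f →
        HasContinuedValue (twistCoeff f χ) (3 / 2) 1 (twistL f χ 1) ∧
        φ 0 =
          Complex.I * gaussSum (star χ) ZMod.stdAddChar * Complex.Gamma (s - 1 / 2) /
            (2 * (Real.pi : ℂ) ^ (1 / 2 : ℂ) * (N : ℂ) ^ (2 * s) * Complex.Gamma s) *
            (twistL f χ 1 * cuspL f (2 * s) /
              (dirichletL (star χ) (2 * s) * dirichletL χ (2 * s)))) := by
  have hs1 : 1 / 2 < s.re := by linarith
  have hexp := hasFourierExpansion_eisensteinCoeff f heven hs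
  refine ⟨summable_eisensteinCosetTerm f heven hs, ⟨_, hexp, fun φ h => h.unique hs1 hexp⟩,
    fun φ hφ => ?_⟩
  obtain rfl := hφ.unique hs1 hexp
  refine ⟨fun n hn => ⟨?_, shiftedConvolution_eq f hprim heven hs hn⟩, fun hf => ?_⟩
  · have h := hasContinuedValue_shiftedCoeff f hprim heven hs n
    rwa [shiftedConvolution, h.continuedValue_eq]
  · obtain ⟨v, hv⟩ := exists_hasContinuedValue_twistCoeff f hprim heven
    obtain rfl : twistL f χ 1 = v := hv.continuedValue_eq
    refine ⟨hv, ?_⟩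
    have h := symbolSeries_zero hprim heven hf hs hv
    have hW := gaussSum_ne_zero_of_isPrimitive _ (isPrimitive_star χ hprim)
    have hG : Gamma s ≠ 0 := Gamma_ne_zero_of_re_pos (by linarith)
    have hN : (N : ℂ) ^ (2 * s) ≠ 0 := by simp [cpow_eq_zero_iff, NeZero.ne N]
    have hre : 1 < (2 * s).re := by simp; linarith
    have hL := dirichletL_ne_zero χ hre
    have hL' := dirichletL_ne_zero (star χ) hre
    have hpi : (π : ℂ) ≠ 0 := by exact_mod_cast Real.pi_pos.ne'
    have hsq : (π : ℂ) ^ (1 / 2 : ℂ) * (π : ℂ) ^ (1 / 2 : ℂ) = π := by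
      rw [← cpow_add _ _ hpi]
      norm_num
    have hsq0 : (π : ℂ) ^ (1 / 2 : ℂ) ≠ 0 := by simp [cpow_eq_zero_iff, hpi]
    rw [eisensteinCoeff, if_pos rfl]
    rw [← hsq] at h
    generalize (π : ℂ) ^ (1 / 2 : ℂ) = q at *
    generalize Gamma (s - 1 / 2) = g
    field_simp at h ⊢
    linear_combination g * h
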